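/- Let $k$ be an infinite field, $R=k[s,t]$, let $R_n$ be the space of homogeneous polynomials of degree $n$ in $R$, and let $n\ge d\ge 2$. Let $\mathcal P_{n,d}\subseteq R_n^{d+1}\cong k^{(d+1)(n+1)}$ be the set of all $(a_0,\dots,a_d)$ such that $a_0,\dots,a_d$ are linearly independent over $k$ and relatively prime in $R$, with the topology induced by the Zariski topology of $R_n^{d+1}$ (closed sets are the common zero sets in $k^{(d+1)(n+1)}$ of sets of polynomials over $k$ in the coefficients of the $a_i$). A $d$-part partition is a tuple of integers $\mu=(\mu_1,\dots,\mu_d)$ with $1\le\mu_1\le\cdots\le\mu_d$; put $|\mu|=\mu_1+\cdots+\mu_d$, and write $\mu'\le\mu$ if $\mu'_1+\cdots+\mu'_j\le\mu_1+\cdots+\mu_j$ for all $1\le j\le d$. A tuple $(a_0,\dots,a_d)\in\mathcal P_{n,d}$ has type $\mu$ if there is a graded exact sequence $$0\to\bigoplus_{i=1}^d R(-n-\mu_i)\xrightarrow{\,A\,}R(-n)^{d+1}\xrightarrow{(a_0,\dots,a_d)}\langle a_0,\dots,a_d\rangle\to 0 .$$ For a $d$-part partition $\mu$ with $|\mu|=n$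 let $\mathcal P^{\mu}_{n,d}$ be the set of elements of $\mathcal P_{n,d}$ of type $\mu$. Theorem 3.6. For every $d$-part partition $\mu$ of $n$, the Zariski closure of $\mathcal P^{\mu}_{n,d}$ in $\mathcal P_{n,d}$ is $$\overline{\mathcal P}^{\mu}_{n,d}=\bigcup_{\mu'\le\mu}\mathcal P^{\mu'}_{n,d},$$ where the union is over all $d$-part partitions $\mu'$ of $n$ with $\mu'\le\mu$. -/

import Mathlib

noncomputable section

namespace RatCurve

open MvPolynomial

/-- The space `R_n` of homogeneous polynomials of degree `n` in `R = k[s,t]`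
(the variables `s`, `t` are `X 0`, `X 1`). -/
abbrev Forms (k : Type*) [Field k] (n : ℕ) : Submodule k (MvPolynomial (Fin 2) k) :=
  homogeneousSubmodule (Fin 2) k n

/-- The affine coordinates on `R_n^{d+1}`, identifying it with `k^{(d+1)(n+1)}`: the coordinate
with index `(i, j)` of `(a_0, …, a_d)` is the coefficient of `s^j t^{n-j}` in `a_i`. -/
def coords (k : Type*) [Field k] (n d : ℕ) (a : Fin (d + 1) → Forms k n) :
    Fin (d + 1) × Fin (n + 1) → k :=
  fun p => coeff (Finsupp.single 0 (p.2 : ℕ) + Finsupp.single 1 (n - (p.2 : ℕ)))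
    (a p.1 : MvPolynomial (Fin 2) k)

/-- The subset of `R_n^{d+1}` cut out by a set `F` of polynomials over `k` in the coordinates. -/
def zeroSet (k : Type*) [Field k] (n d : ℕ)
    (F : Set (MvPolynomial (Fin (d + 1) × Fin (n + 1)) k)) : Set (Fin (d + 1) → Forms k n) :=
  {a | ∀ f ∈ F, eval (coords k n d a) f = 0}

/-- The Zariski topology on `R_n^{d+1}`: the closed sets are the zero sets of sets of
polynomials. -/
abbrev zariskiTopology (k : Type*) [Field k] (n d : ℕ) :
    TopologicalSpace (Fin (d + 1) → Forms k n) :=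
  TopologicalSpace.ofClosed (Set.range (zeroSet k n d))
    ⟨{1}, by ext a; simp [zeroSet]⟩
    (by
      intro 𝒜 h𝒜
      refine ⟨{f | ∃ F, zeroSet k n d F ∈ 𝒜 ∧ f ∈ F}, ?_⟩
      ext a
      constructor
      · intro ha Z hZ
        obtain ⟨F, rfl⟩ := h𝒜 hZ
        exact fun f hf => ha f ⟨F, hZ, hf⟩
      · rintro ha f ⟨F, hF, hf⟩
        exact ha _ hF f hf)
    (by
      rintro _ ⟨F, rfl⟩ _ ⟨G, rfl⟩
      refine ⟨{h | ∃ f ∈ F, ∃ g ∈ G, h = f * g}, ?_⟩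
      ext a
      constructor
      · intro ha
        by_contra hcon
        simp only [zeroSet, Set.mem_union, Set.mem_ofPred_eq, not_or, not_forall] at hcon
        obtain ⟨⟨f, hf, hfa⟩, g, hg, hga⟩ := hcon
        have h := ha (f * g) ⟨f, hf, g, hg, rfl⟩
        rw [map_mul] at h
        exact (mul_eq_zero.1 h).elim hfa hga
      · rintro (ha | ha) _ ⟨f, hf, g, hg, rfl⟩
        · rw [map_mul, ha f hf, zero_mul]
        · rw [map_mul, ha g hg, mul_zero])

/-- The space `P_{n,d}` of all `(a_0, …, a_d) ∈ R_n^{d+1}` whose entries are linearly independent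
over `k` and relatively prime in `k[s,t]`. -/
def ParamSpace (k : Type*) [Field k] (n d : ℕ) : Type _ :=
  {a : Fin (d + 1) → Forms k n //
    LinearIndependent k a ∧
      ∀ g : MvPolynomial (Fin 2) k,
        (∀ i, g ∣ (a i : MvPolynomial (Fin 2) k)) → IsUnit g}

/-- `P_{n,d}` carries the topology induced by the Zariski topology of `R_n^{d+1}`. -/
instance (k : Type*) [Field k] (n d : ℕ) : TopologicalSpace (ParamSpace k n d) :=
  (zariskiTopology k n d).induced Subtype.val

/-- A `d`-part partition: integers `1 ≤ μ_1 ≤ ⋯ ≤ μ_d`. -/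
structure DPartPartition (d : ℕ) where
  parts : Fin d → ℕ
  one_le : ∀ i, 1 ≤ parts i
  mono : Monotone parts

/-- `|μ| = μ_1 + ⋯ + μ_d`. -/
def DPartPartition.size {d : ℕ} (μ : DPartPartition d) : ℕ := ∑ i, μ.parts i

/-- `μ ≤ μ'` when `μ_1 + ⋯ + μ_j ≤ μ'_1 + ⋯ + μ'_j` for all `j`. -/
instance (d : ℕ) : LE (DPartPartition d) :=
  ⟨fun μ μ' => ∀ j : Fin d, ∑ i ∈ Finset.Iic j, μ.parts i ≤ ∑ i ∈ Finset.Iic j, μ'.parts i⟩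

/-- `(a_0, …, a_d)` has type `μ`: there is a graded exact sequence
`0 → ⨁ i, R(-n-μ_i) → R(-n)^{d+1} → ⟨a_0, …, a_d⟩ → 0`, where the first map is a matrix `A` whose
`j`-th column is homogeneous of degree `μ_j`, and the second map is `(a_0, …, a_d)` (which is
onto the ideal by definition). The columns of `A` are a `μ`-basis. -/
def HasMuType {k : Type*} [Field k] {n d : ℕ} (a : Fin (d + 1) → Forms k n)
    (μ : DPartPartition d) : Prop :=
  ∃ A : Matrix (Fin (d + 1)) (Fin d) (MvPolynomial (Fin 2) k),
    (∀ i j, (A i j).IsHomogeneous (μ.parts j)) ∧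
    Function.Injective A.mulVec ∧
    Function.Exact A.mulVec
      (fun v : Fin (d + 1) → MvPolynomial (Fin 2) k => ∑ i, v i * (a i : MvPolynomial (Fin 2) k))

/-- The `μ`-stratum of `P_{n,d}`. -/
def stratum (k : Type*) [Field k] (n d : ℕ) (μ : DPartPartition d) : Set (ParamSpace k n d) :=
  {a | HasMuType a.1 μ}

end RatCurve

end

/-! The proof needs three facts: the strata cover the parameter space, semicontinuity of ranks
bounds the closure of a stratum from above, and explicit deformations bound it from below.

Covering: every tuple has a `μ`-basis (`exists_hasMuType`). The values at `(s, t) = (0, 1)` of the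
syzygies of degree `M` form a filtration that ends at a hyperplane of `k^(d+1)`. Syzygies lifting a
basis adapted to this filtration generate all syzygies, because a syzygy vanishing at `(0, 1)` is
`s` times one of lower degree. Comparing degrees in Hilbert–Burch then gives `|μ| = n`.

Upper bound: for a tuple of type `μ`, the kernel of `(R_M)^(d+1) → R_(M+n)` has dimension `∑ j,
max(0, M + 1 - μ_j)`. Rank can only drop under specialization, so this kernel can only grow. The
resulting inequalities for all `M` amount to dominance (`le_of_forall_sum_tsub_le`).

Lower bound: dominance is generated by moves that bring two parts differing by at least 2 one unit
closer (`exists_move`). For one move, let `A` be a `μ'`-basis of `a`, with columns `A_i`, `A_j` of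
degrees `μ'_i + 2 ≤ μ'_j`, and write `A_j = s u + t^e v` with `deg v = μ'_i + 1`. Replacing `A_i`,
`A_j` by `c v + s A_i`, `c u - t^e A_i` gives the new degrees, and the minors become `c (minors A +
c E)`, where `E` does not depend on `c`. So `a` lies on a line `a + τ E` whose points with `τ ≠ 0`
have the new type wherever they remain relatively prime. As `k` is infinite, no polynomial that is
nonzero at `a` vanishes at all those points (`stratum_subset_closure_of_move`). -/

namespace RatCurve

open MvPolynomial

/-! ### Binary forms and their coefficients -/

section Forms

variable {k : Type*} [Field k]

/-- The point `(s, t) = (0, 1)`. -/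
def basePt (k : Type*) [Field k] : Fin 2 → k := ![0, 1]

/-- The exponent of the monomial `s^j t^(m-j)`. -/
noncomputable def expo (m j : ℕ) : Fin 2 →₀ ℕ := Finsupp.single 0 j + Finsupp.single 1 (m - j)

theorem expo_injective (m : ℕ) : Function.Injective (expo m) := by
  intro i j h
  have := DFunLike.congr_fun h 0
  simpa [expo] using this

theorem degree_fin_two (e : Fin 2 →₀ ℕ) : e.degree = e 0 + e 1 := by
  rw [Finsupp.degree_eq_sum, Fin.sum_univ_two]

theorem eq_expo {m : ℕ} {e : Fin 2 →₀ ℕ} (he : e.degree = m) : e = expo m (e 0) := by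
  rw [degree_fin_two] at he
  ext i
  fin_cases i
  · simp [expo]
  · simp [expo]; omega

theorem degree_expo {m j : ℕ} (h : j ≤ m) : (expo m j).degree = m := by
  rw [degree_fin_two]
  simp [expo]
  omega

/-- A form is determined by its coefficients. -/
theorem ext_of_coeff_expo {m : ℕ} {f g : MvPolynomial (Fin 2) k} (hf : f.IsHomogeneous m)
    (hg : g.IsHomogeneous m) (h : ∀ j : Fin (m + 1), coeff (expo m j) f = coeff (expo m j) g) :
    f = g := by
  ext e
  by_cases he : e.degree = m
  · have h0 : e 0 < m + 1 := by rw [degree_fin_two] at he; omega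
    have := h ⟨e 0, h0⟩
    rwa [← eq_expo he] at this
  · rw [hf.coeff_eq_zero he, hg.coeff_eq_zero he]

theorem monomial_expo (m j : ℕ) (c : k) :
    monomial (expo m j) c = C c * (X 0 ^ j * X 1 ^ (m - j)) := by
  rw [expo, monomial_eq, Finsupp.prod_fintype _ _ (by simp)]
  simp

theorem coeff_sum_monomial_expo {m : ℕ} (c : Fin (m + 1) → k) (j : Fin (m + 1)) :
    coeff (expo m j) (∑ i : Fin (m + 1), monomial (expo m i) (c i)) = c j := by
  classical
  rw [coeff_sum]
  simp only [coeff_monomial, (expo_injective m).eq_iff, Fin.val_inj]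
  simp

theorem isHomogeneous_sum_monomial_expo {m : ℕ} (c : Fin (m + 1) → k) :
    (∑ i : Fin (m + 1), monomial (expo m i) (c i)).IsHomogeneous m :=
  IsHomogeneous.sum _ _ _ fun i _ => isHomogeneous_monomial _ (degree_expo (by omega))

theorem eq_sum_monomial_expo {m : ℕ} {f : MvPolynomial (Fin 2) k} (hf : f.IsHomogeneous m) :
    f = ∑ j : Fin (m + 1), monomial (expo m j) (coeff (expo m j) f) :=
  ext_of_coeff_expo hf (isHomogeneous_sum_monomial_expo _) fun j =>
    (coeff_sum_monomial_expo (fun j : Fin (m + 1) => coeff (expo m j) f) j).symm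

/-- The coefficient isomorphism `R_m ≅ k^(m+1)`. -/
noncomputable def formsEquiv (k : Type*) [Field k] (m : ℕ) : Forms k m ≃ₗ[k] (Fin (m + 1) → k) where
  toFun f j := coeff (expo m j) (f : MvPolynomial (Fin 2) k)
  map_add' f g := by ext; simp
  map_smul' c f := by ext; simp
  invFun c := ⟨∑ i : Fin (m + 1), monomial (expo m i) (c i), isHomogeneous_sum_monomial_expo c⟩
  left_inv f := Subtype.ext (eq_sum_monomial_expo f.2).symm
  right_inv c := funext fun j => coeff_sum_monomial_expo c j

instance finite_forms (m : ℕ) : Module.Finite k (Forms k m) :=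
  Module.Finite.equiv (formsEquiv k m).symm

theorem finrank_forms (m : ℕ) : Module.finrank k (Forms k m) = m + 1 := by
  rw [(formsEquiv k m).finrank_eq]; simp

/-- A form vanishing at `(0, 1)` is divisible by `s`. -/
theorem exists_eq_X_mul {m : ℕ} {f : MvPolynomial (Fin 2) k} (hf : f.IsHomogeneous m)
    (h : eval (basePt k) f = 0) :
    ∃ u : MvPolynomial (Fin 2) k, u.IsHomogeneous (m - 1) ∧ f = X 0 * u := by
  have hs := eq_sum_monomial_expo hf
  rw [Fin.sum_univ_succ] at hs
  have h0 : coeff (expo m (0 : Fin (m + 1))) f = 0 := by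
    rw [hs] at h
    simpa [monomial_expo, basePt] using h
  refine ⟨∑ j : Fin m, monomial (expo (m - 1) j) (coeff (expo m (j.succ : Fin (m + 1))) f),
    IsHomogeneous.sum _ _ _ fun i _ => isHomogeneous_monomial _ (degree_expo (by omega)), ?_⟩
  rw [h0, monomial_zero, zero_add] at hs
  conv_lhs => rw [hs]
  rw [Finset.mul_sum]
  refine Finset.sum_congr rfl fun j _ => ?_
  rw [monomial_expo, monomial_expo, Fin.val_succ, pow_succ,
    show m - (j + 1) = m - 1 - (j : ℕ) by omega]
  ring

/-- Every form of degree `m` is `s u + c t^m`. -/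
theorem exists_eq_X_mul_add {m : ℕ} {f : MvPolynomial (Fin 2) k} (hf : f.IsHomogeneous m) :
    ∃ (u : MvPolynomial (Fin 2) k) (c : k), u.IsHomogeneous (m - 1) ∧
      f = X 0 * u + C c * X 1 ^ m := by
  obtain ⟨u, hu, h⟩ := exists_eq_X_mul
    (hf.sub (isHomogeneous_C_mul_X_pow (eval (basePt k) f) (1 : Fin 2) m)) (by simp [basePt])
  exact ⟨u, _, hu, by rw [← h]; ring⟩

variable {n d : ℕ}

/-- Linear functionals on `R_n^(d+1)` are polynomials in the coordinates. -/
theorem exists_poly_eq_linear (L : (Fin (d + 1) → Forms k n) →ₗ[k] k) :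
    ∃ f : MvPolynomial (Fin (d + 1) × Fin (n + 1)) k, ∀ a, eval (coords k n d a) f = L a := by
  classical
  let e : (Fin (d + 1) → Forms k n) ≃ₗ[k] (Fin (d + 1) × Fin (n + 1) → k) :=
    (LinearEquiv.piCongrRight fun _ => formsEquiv k n).trans
      (LinearEquiv.curry k k (Fin (d + 1)) (Fin (n + 1))).symm
  refine ⟨∑ p, C (L (e.symm (Pi.single p 1))) * X p, fun a => ?_⟩
  have he : e a = coords k n d a := rfl
  have h2 : e a = ∑ p, coords k n d a p • Pi.single p (1 : k) := by
    rw [he]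
    exact pi_eq_sum_univ' _
  have h3 : L a = L (e.symm (e a)) := by simp
  rw [h3, h2]
  simp [mul_comm]

end Forms

/-! ### Closures and open conditions in the Zariski topology -/

section Zariski

variable {k : Type*} [Field k] {n d : ℕ}

theorem mem_closure_iff_val {S : Set (ParamSpace k n d)} {a : ParamSpace k n d} :
    a ∈ closure S ↔
      a.1 ∈ @closure _ (zariskiTopology k n d) ((fun b : ParamSpace k n d => b.1) '' S) :=
  @closure_induced _ _ (zariskiTopology k n d) (fun b : ParamSpace k n d => b.1) a S

/-- The sets `f ≠ 0` form a base of the topology, so closure can be tested one polynomial at a time.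
-/
theorem mem_closure_of_poly {S : Set (ParamSpace k n d)} {a : ParamSpace k n d}
    (h : ∀ f : MvPolynomial (Fin (d + 1) × Fin (n + 1)) k, eval (coords k n d a.1) f ≠ 0 →
      ∃ b ∈ S, eval (coords k n d b.1) f ≠ 0) : a ∈ closure S := by
  let := zariskiTopology k n d
  rw [mem_closure_iff_val, mem_closure_iff]
  rintro o ⟨F, hF⟩ ha
  have ha' : a.1 ∉ zeroSet k n d F := by rw [hF]; exact fun h => h ha
  simp only [zeroSet, Set.mem_ofPred_eq, not_forall] at ha'
  obtain ⟨f, hf, hfa⟩ := ha'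
  obtain ⟨b, hb, hfb⟩ := h f hfa
  refine ⟨b.1, ?_, b, hb, rfl⟩
  by_contra hbo
  have : b.1 ∈ zeroSet k n d F := by rw [hF]; exact hbo
  exact hfb (this f hf)

theorem exists_of_mem_closure {S : Set (ParamSpace k n d)} {a : ParamSpace k n d}
    (h : a ∈ closure S) {f : MvPolynomial (Fin (d + 1) × Fin (n + 1)) k}
    (hf : eval (coords k n d a.1) f ≠ 0) : ∃ b ∈ S, eval (coords k n d b.1) f ≠ 0 := by
  let := zariskiTopology k n d
  rw [mem_closure_iff_val, mem_closure_iff] at h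
  obtain ⟨_, hb, b, hbS, rfl⟩ := h (zeroSet k n d {f})ᶜ
    ⟨{f}, by rw [compl_compl]⟩ (fun hz => hf (hz f rfl))
  exact ⟨b, hbS, fun h0 => hb fun g hg => by rw [Set.mem_singleton_iff.1 hg]; exact h0⟩

/-- Linear independence of vectors depending linearly on `a` is an open condition on `a`. -/
theorem exists_poly_of_linearIndependent {V : Type*} [AddCommGroup V] [Module k V] {r : ℕ}
    (Φ : Fin r → (Fin (d + 1) → Forms k n) →ₗ[k] V) {a : Fin (d + 1) → Forms k n}
    (ha : LinearIndependent k fun y => Φ y a) :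
    ∃ f : MvPolynomial (Fin (d + 1) × Fin (n + 1)) k, eval (coords k n d a) f ≠ 0 ∧
      ∀ b, eval (coords k n d b) f ≠ 0 → LinearIndependent k fun y => Φ y b := by
  classical
  -- With `g` a left inverse at `a`, the matrix of `g (Φ y b)` is the identity at `b = a`; its
  -- determinant is the required polynomial in `b`.
  obtain ⟨g, hg⟩ := LinearMap.exists_leftInverse_of_injective
    (Fintype.linearCombination k fun y => Φ y a)
    (LinearMap.ker_eq_bot.2 (linearIndependent_iff_injective_fintypeLinearCombination.1 ha))
  choose ℓ hℓ using fun x y : Fin r =>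
    exists_poly_eq_linear (LinearMap.proj x ∘ₗ g ∘ₗ Φ y)
  have key : ∀ b, eval (coords k n d b) (Matrix.of ℓ).det =
      (Matrix.of fun x y => g (Φ y b) x).det := by
    intro b
    rw [RingHom.map_det]
    congr 1
    ext x y
    simp [hℓ]
  refine ⟨(Matrix.of ℓ).det, ?_, fun b hb => ?_⟩
  · rw [key]
    have : (Matrix.of fun x y => g (Φ y a) x) = (1 : Matrix (Fin r) (Fin r) k) := by
      ext x y
      have := LinearMap.congr_fun hg (Pi.single y 1)
      simp only [LinearMap.comp_apply, Fintype.linearCombination_apply_single, one_smul,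
        LinearMap.id_apply] at this
      simp [this, Matrix.one_apply, Pi.single_apply]
    rw [this, Matrix.det_one]
    exact one_ne_zero
  · rw [key] at hb
    have h1 : LinearIndependent k fun y => g (Φ y b) :=
      Matrix.linearIndependent_cols_iff_isUnit.2
        ((Matrix.isUnit_iff_isUnit_det _).2 (isUnit_iff_ne_zero.2 hb))
    exact LinearIndependent.of_comp g h1

end Zariski

/-! ### Maximal minors and the Hilbert–Burch theorem -/

section Minors

variable {R : Type*} [CommRing R] {d : ℕ}

/-- The signed maximal minors of a `(d+1) × d` matrix. -/
def minors (A : Matrix (Fin (d + 1)) (Fin d) R) (l : Fin (d + 1)) : R :=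
  (-1) ^ (l : ℕ) * (A.submatrix l.succAbove id).det

theorem sum_mul_minors (v : Fin (d + 1) → R) (A : Matrix (Fin (d + 1)) (Fin d) R) :
    ∑ l, v l * minors A l =
      (Matrix.of fun i => (Fin.cons (v i) (A i) : Fin (d + 1) → R)).det := by
  rw [Matrix.det_succ_column_zero]
  refine Finset.sum_congr rfl fun l _ => ?_
  have : (Matrix.of fun i => (Fin.cons (v i) (A i) : Fin (d + 1) → R)).submatrix
      l.succAbove Fin.succ = A.submatrix l.succAbove id := by
    ext i j; simp
  rw [this, minors]
  simp
  ring

theorem sum_mul_minors_col (A : Matrix (Fin (d + 1)) (Fin d) R) (j : Fin d) :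
    ∑ l, A l j * minors A l = 0 := by
  rw [sum_mul_minors]
  exact Matrix.det_zero_of_column_eq (Fin.succ_ne_zero j).symm fun i => by simp

theorem minors_map {S : Type*} [CommRing S] (f : R →+* S) (A : Matrix (Fin (d + 1)) (Fin d) R)
    (l : Fin (d + 1)) : minors (A.map f) l = f (minors A l) := by
  rw [minors, minors, map_mul, RingHom.map_det, map_pow, map_neg, map_one]
  rfl

/-- A vector outside the span of the columns completes them to an invertible matrix; Laplace
expansion along the added column writes its determinant through the minors. -/
theorem exists_minors_ne_zero_of_field {K : Type*} [Field K]
    {A : Matrix (Fin (d + 1)) (Fin d) K} (h : LinearIndependent K A.col) :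
    ∃ l, minors A l ≠ 0 := by
  have hlt : Submodule.span K (Set.range A.col) < ⊤ := by
    refine Submodule.lt_top_of_finrank_lt_finrank ?_
    rw [finrank_span_eq_card h]
    simp
  obtain ⟨v, -, hv⟩ := SetLike.exists_of_lt hlt
  have h2 : LinearIndependent K (Fin.cons v A.col : Fin (d + 1) → _) :=
    linearIndependent_finCons.2 ⟨h, hv⟩
  have h3 : (Fin.cons v A.col : Fin (d + 1) → _) =
      (Matrix.of fun i => (Fin.cons (v i) (A i) : Fin (d + 1) → K)).col := by
    ext j i
    refine Fin.cases ?_ (fun j => ?_) j <;> simp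
  rw [h3, Matrix.linearIndependent_cols_iff_isUnit, Matrix.isUnit_iff_isUnit_det,
    ← sum_mul_minors] at h2
  by_contra hcon
  push Not at hcon
  simp [hcon] at h2

theorem exists_minors_ne_zero [IsDomain R] {A : Matrix (Fin (d + 1)) (Fin d) R}
    (h : Function.Injective A.mulVec) : ∃ l, minors A l ≠ 0 := by
  have h1 : LinearIndependent R A.col := Matrix.mulVec_injective_iff.1 h
  let K := FractionRing R
  have h2 : LinearIndependent K (A.map (algebraMap R K)).col := by
    have := (h1.map' ((Algebra.linearMap R K).compLeft (Fin (d + 1))) (by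
      rw [LinearMap.ker_eq_bot]
      intro x y hxy
      ext i
      exact IsFractionRing.injective R K (congrFun hxy i)))
    exact (LinearIndependent.iff_fractionRing R K).1 this
  obtain ⟨l, hl⟩ := exists_minors_ne_zero_of_field h2
  rw [minors_map] at hl
  exact ⟨l, fun h0 => hl (by rw [h0, map_zero])⟩

theorem det_ne_zero_of_minors_ne_zero {A : Matrix (Fin (d + 1)) (Fin d) R} {l : Fin (d + 1)}
    (hl : minors A l ≠ 0) : (A.submatrix l.succAbove id).det ≠ 0 :=
  fun h0 => hl (by rw [minors, h0, mul_zero])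

theorem mulVec_injective_of_minors_ne_zero [IsDomain R] {A : Matrix (Fin (d + 1)) (Fin d) R}
    {l : Fin (d + 1)} (hl : minors A l ≠ 0) : Function.Injective A.mulVec := by
  intro x y hxy
  rw [← sub_eq_zero]
  refine Matrix.eq_zero_of_mulVec_eq_zero (det_ne_zero_of_minors_ne_zero hl) ?_
  have : A.mulVec (x - y) = 0 := by rw [Matrix.mulVec_sub]; exact sub_eq_zero.2 hxy
  ext i
  exact congrFun this (l.succAbove i)

/-- A divisor of all `a i * w`, with the `a i` relatively prime, divides `w`. -/
theorem dvd_of_forall_dvd_mul [IsDomain R] [UniqueFactorizationMonoid R] {ι : Type*} [Fintype ι]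
    {a : ι → R} (hco : ∀ g, (∀ i, g ∣ a i) → IsUnit g) {D w : R} (h : ∀ i, D ∣ a i * w) :
    D ∣ w := by
  classical
  let : StrongNormalizationMonoid R := UniqueFactorizationMonoid.strongNormalizationMonoid
  let := UniqueFactorizationMonoid.toNormalizedGCDMonoid R
  have h1 : D ∣ Finset.univ.gcd fun i => a i * w := Finset.dvd_gcd fun i _ => h i
  have h2 : D ∣ Finset.univ.gcd a * w :=
    (Finset.gcd_mul_right' Finset.univ a w).dvd_iff_dvd_right.1 h1
  exact (hco _ fun i => Finset.gcd_dvd (Finset.mem_univ i)).dvd_mul_left.1 h2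

/-- Hilbert–Burch: a relatively prime vector killed by `A` is proportional to the minors. -/
theorem exists_minors_eq_mul [IsDomain R] [UniqueFactorizationMonoid R]
    {A : Matrix (Fin (d + 1)) (Fin d) R} (hA : Function.Injective A.mulVec)
    {a : Fin (d + 1) → R} (hco : ∀ g, (∀ i, g ∣ a i) → IsUnit g) (ha : a ≠ 0)
    (haA : ∀ j, ∑ i, A i j * a i = 0) :
    ∃ c, c ≠ 0 ∧ ∀ l, minors A l = c * a l := by
  obtain ⟨l₀, hl₀⟩ := exists_minors_ne_zero hA
  have key : ∀ l, minors A l₀ * a l = a l₀ * minors A l := by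
    -- The vector `minors A l₀ • a - a l₀ • minors A` is killed by the columns of `A` and vanishes
    -- at `l₀`, so the nonsingular block omitting row `l₀` forces it to be zero.
    have hz : (fun i : Fin d => minors A l₀ * a (l₀.succAbove i) -
        a l₀ * minors A (l₀.succAbove i)) = 0 := by
      refine Matrix.eq_zero_of_vecMul_eq_zero (det_ne_zero_of_minors_ne_zero hl₀) ?_
      ext j
      have h1 := haA j
      have h2 := sum_mul_minors_col A j
      rw [Fin.sum_univ_succAbove _ l₀] at h1 h2
      simp only [Matrix.vecMul, dotProduct, Matrix.submatrix_apply, id, Pi.zero_apply, sub_mul,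
        Finset.sum_sub_distrib]
      have e1 : ∑ x, minors A l₀ * a (l₀.succAbove x) * A (l₀.succAbove x) j =
          minors A l₀ * ∑ x, A (l₀.succAbove x) j * a (l₀.succAbove x) := by
        rw [Finset.mul_sum]; exact Finset.sum_congr rfl fun x _ => by ring
      have e2 : ∑ x, a l₀ * minors A (l₀.succAbove x) * A (l₀.succAbove x) j =
          a l₀ * ∑ x, A (l₀.succAbove x) j * minors A (l₀.succAbove x) := by
        rw [Finset.mul_sum]; exact Finset.sum_congr rfl fun x _ => by ring
      rw [e1, e2]
      linear_combination minors A l₀ * h1 - a l₀ * h2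
    intro l
    by_cases hl : l = l₀
    · rw [hl, mul_comm]
    · obtain ⟨i, rfl⟩ := Fin.exists_succAbove_eq hl
      exact sub_eq_zero.1 (congrFun hz i)
  have ha₀ : a l₀ ≠ 0 := by
    intro h0
    apply ha
    ext l
    have := key l
    rw [h0, zero_mul] at this
    exact (mul_eq_zero.1 this).resolve_left hl₀
  obtain ⟨c, hc⟩ : a l₀ ∣ minors A l₀ :=
    dvd_of_forall_dvd_mul hco fun l => ⟨minors A l, by rw [← key l, mul_comm]⟩
  refine ⟨c, ?_, fun l => ?_⟩
  · rintro rfl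
    exact hl₀ (by rw [hc, mul_zero])
  · have := key l
    rw [hc, mul_assoc] at this
    exact (mul_left_cancel₀ ha₀ this).symm

/-- Hilbert–Burch: a matrix with relatively prime minors resolves them. -/
theorem exact_of_minors [IsDomain R] [UniqueFactorizationMonoid R]
    {A : Matrix (Fin (d + 1)) (Fin d) R} {a : Fin (d + 1) → R}
    (hco : ∀ g, (∀ i, g ∣ a i) → IsUnit g) (ha : a ≠ 0) (hm : ∀ l, minors A l = a l) :
    Function.Injective A.mulVec ∧
      Function.Exact A.mulVec (fun v : Fin (d + 1) → R => ∑ i, v i * a i) := by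
  obtain ⟨l₀, hl₀⟩ := Function.ne_iff.1 ha
  have hl₀' : minors A l₀ ≠ 0 := by rw [hm]; exact hl₀
  have hinj := mulVec_injective_of_minors_ne_zero hl₀'
  have haA : ∀ w, ∑ i, A.mulVec w i * a i = 0 := by
    intro w
    simp only [Matrix.mulVec, dotProduct, Finset.sum_mul]
    rw [Finset.sum_comm]
    refine Finset.sum_eq_zero fun j _ => ?_
    have := sum_mul_minors_col A j
    calc ∑ i, A i j * w j * a i = w j * ∑ i, A i j * minors A i := by
          rw [Finset.mul_sum]; exact Finset.sum_congr rfl fun i _ => by rw [hm]; ring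
      _ = 0 := by rw [this, mul_zero]
  refine ⟨hinj, fun v => ⟨fun hv => ?_, ?_⟩⟩
  -- Cramer's rule solves the system up to the factor `a l`: the rows other than `l` directly, and
  -- row `l` because both sides are orthogonal to `a`.
  · have cramer : ∀ l, ∃ w, A.mulVec w = a l • v := by
      intro l
      by_cases hl : a l = 0
      · exact ⟨0, by rw [hl, Matrix.mulVec_zero, zero_smul]⟩
      set B := A.submatrix l.succAbove id with hB
      let w : Fin d → R := (-1 : R) ^ (l : ℕ) • B.adjugate.mulVec (fun i => v (l.succAbove i))
      have hrow : ∀ i, A.mulVec w (l.succAbove i) = a l * v (l.succAbove i) := by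
        intro i
        have h1 : A.mulVec w (l.succAbove i) = B.mulVec w i := rfl
        rw [h1, ← hm, minors]
        simp only [w, Matrix.mulVec_smul, Matrix.mulVec_mulVec, Matrix.mul_adjugate,
          Matrix.smul_mulVec, Matrix.one_mulVec, Pi.smul_apply, smul_eq_mul, hB]
        ring
      refine ⟨w, ?_⟩
      have h2 := haA w
      rw [Fin.sum_univ_succAbove _ l] at h2
      have h3 : ∑ i, v i * a i = 0 := hv
      rw [Fin.sum_univ_succAbove _ l] at h3
      simp only [hrow] at h2
      have h4 : a l * (A.mulVec w l - a l * v l) = 0 := by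
        have : ∑ x, a l * v (l.succAbove x) * a (l.succAbove x) =
            a l * ∑ x, v (l.succAbove x) * a (l.succAbove x) := by
          rw [Finset.mul_sum]; exact Finset.sum_congr rfl fun x _ => by ring
        rw [this] at h2
        linear_combination h2 - a l * h3
      ext i
      by_cases hi : i = l
      · rw [hi]
        simpa using sub_eq_zero.1 ((mul_eq_zero.1 h4).resolve_left hl)
      · obtain ⟨i, rfl⟩ := Fin.exists_succAbove_eq hi
        simpa using hrow i
    choose w hw using cramer
    have hcomm : ∀ l, a l • w l₀ = a l₀ • w l := by
      intro l
      apply hinj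
      rw [Matrix.mulVec_smul, Matrix.mulVec_smul, hw, hw, smul_smul, smul_smul, mul_comm]
    -- The denominators cancel: `a l₀` divides every `a l * w l₀ j`, and the `a l` are relatively
    -- prime.
    have hdvd : ∀ j, a l₀ ∣ w l₀ j := fun j =>
      dvd_of_forall_dvd_mul hco fun l => ⟨w l j, congrFun (hcomm l) j⟩
    choose u hu using hdvd
    refine ⟨u, ?_⟩
    have h5 : w l₀ = a l₀ • u := funext hu
    have h6 := hw l₀
    rw [h5, Matrix.mulVec_smul] at h6
    ext i
    exact mul_left_cancel₀ hl₀ (congrFun h6 i)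
  · rintro ⟨w, rfl⟩
    exact haA w

theorem isHomogeneous_minors {k : Type*} [Field k]
    {A : Matrix (Fin (d + 1)) (Fin d) (MvPolynomial (Fin 2) k)} {p : Fin d → ℕ}
    (hA : ∀ i j, (A i j).IsHomogeneous (p j)) (l : Fin (d + 1)) :
    (minors A l).IsHomogeneous (∑ j, p j) := by
  have h1 : ((-1 : MvPolynomial (Fin 2) k) ^ (l : ℕ)).IsHomogeneous 0 := by
    have := (isHomogeneous_C (Fin 2) (-1 : k)).pow (l : ℕ)
    simpa using this
  rw [minors, ← zero_add (∑ j, p j)]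
  refine h1.mul ?_
  rw [Matrix.det_apply]
  refine IsHomogeneous.sum _ _ _ fun σ _ => ?_
  have h2 := IsHomogeneous.prod Finset.univ
    (fun i => A.submatrix l.succAbove id (σ i) i) p fun i _ => hA _ _
  rcases Int.units_eq_one_or (Equiv.Perm.sign σ) with h | h
  · rw [h, one_smul]; exact h2
  · rw [h, Units.neg_smul, one_smul]; exact h2.neg

end Minors

/-! ### Hilbert functions of syzygies, and type read off from minors -/

section Syzygies

variable {k : Type*} [Field k] {n d : ℕ}

attribute [local instance] MvPolynomial.gradedAlgebra in
theorem homogeneousComponent_mul_of_le {p M : ℕ} {f g : MvPolynomial (Fin 2) k}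
    (hf : f.IsHomogeneous p) (h : p ≤ M) :
    homogeneousComponent M (f * g) = f * homogeneousComponent (M - p) g := by
  have := DirectSum.coe_decompose_mul_of_left_mem_of_le (homogeneousSubmodule (Fin 2) k)
    (b := g) ((mem_homogeneousSubmodule p f).2 hf) h
  rw [← decomposition.decompose'_apply, ← decomposition.decompose'_apply]
  exact this

attribute [local instance] MvPolynomial.gradedAlgebra in
theorem homogeneousComponent_mul_of_lt {p M : ℕ} {f g : MvPolynomial (Fin 2) k}
    (hf : f.IsHomogeneous p) (h : M < p) : homogeneousComponent M (f * g) = 0 := by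
  have := DirectSum.coe_decompose_mul_of_left_mem_of_not_le (homogeneousSubmodule (Fin 2) k)
    (b := g) ((mem_homogeneousSubmodule p f).2 hf) (not_le.2 h)
  rw [← decomposition.decompose'_apply]
  exact this

/-- The pairing `(v, a) ↦ ∑ i, v_i a_i`. -/
noncomputable def pairing (k : Type*) [Field k] (n d M : ℕ) :
    (Fin (d + 1) → Forms k M) →ₗ[k] (Fin (d + 1) → Forms k n) →ₗ[k] MvPolynomial (Fin 2) k :=
  LinearMap.mk₂ k (fun v a => ∑ i, (v i : MvPolynomial (Fin 2) k) * a i)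
    (fun v w a => by simp [add_mul, Finset.sum_add_distrib])
    (fun c v a => by simp [Finset.smul_sum])
    (fun v a b => by simp [mul_add, Finset.sum_add_distrib])
    (fun c v a => by simp [Finset.smul_sum])

theorem pairing_apply {M : ℕ} (v : Fin (d + 1) → Forms k M) (a : Fin (d + 1) → Forms k n) :
    pairing k n d M v a = ∑ i, (v i : MvPolynomial (Fin 2) k) * a i := rfl

theorem range_pairing_le (a : Fin (d + 1) → Forms k n) (M : ℕ) :
    LinearMap.range ((pairing k n d M).flip a) ≤ Forms k (M + n) := by
  rintro _ ⟨v, rfl⟩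
  exact IsHomogeneous.sum _ _ _ fun i _ => (v i).2.mul (a i).2

theorem finrank_tuples (M : ℕ) :
    Module.finrank k (Fin (d + 1) → Forms k M) = (d + 1) * (M + 1) := by
  rw [Module.finrank_pi_fintype]
  simp [finrank_forms]

/-- The rank of `(R_M)^(d+1) → R_(M+n)` is lower semicontinuous in `a`. -/
theorem exists_poly_finrank_range_le (a : Fin (d + 1) → Forms k n) (M : ℕ) :
    ∃ f : MvPolynomial (Fin (d + 1) × Fin (n + 1)) k, eval (coords k n d a) f ≠ 0 ∧
      ∀ b, eval (coords k n d b) f ≠ 0 →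
        Module.finrank k (LinearMap.range ((pairing k n d M).flip a)) ≤
          Module.finrank k (LinearMap.range ((pairing k n d M).flip b)) := by
  let B := Module.finBasis k (LinearMap.range ((pairing k n d M).flip a))
  choose v hv using fun y => (B y).2
  obtain ⟨f, hf, hf'⟩ := exists_poly_of_linearIndependent (a := a)
    (fun y => pairing k n d M (v y)) (by
      have := B.linearIndependent.map' (Submodule.subtype _) (Submodule.ker_subtype _)
      rwa [show Submodule.subtype _ ∘ B = fun y => pairing k n d M (v y) a from
        funext fun y => (hv y).symm] at this)
  refine ⟨f, hf, fun b hb => ?_⟩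
  have h1 := hf' b hb
  have h2 : LinearIndependent k fun y =>
      (⟨pairing k n d M (v y) b, v y, rfl⟩ : LinearMap.range ((pairing k n d M).flip b)) :=
    LinearIndependent.of_comp (Submodule.subtype _) h1
  simpa using h2.fintype_card_le_finrank

theorem not_X_zero_dvd_X_one : ¬ (X 0 : MvPolynomial (Fin 2) k) ∣ X 1 := by
  rintro ⟨g, hg⟩
  have := congrArg (eval (basePt k)) hg
  simp [basePt] at this

/-- If `⟨a_0, …, a_d⟩` contains all forms of some degree, the `a_i` are relatively prime. -/
theorem isUnit_of_finrank_range {a : Fin (d + 1) → Forms k n} {M : ℕ}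
    (h : M + n + 1 ≤ Module.finrank k (LinearMap.range ((pairing k n d M).flip a)))
    {g : MvPolynomial (Fin 2) k} (hg : ∀ i, g ∣ (a i : MvPolynomial (Fin 2) k)) : IsUnit g := by
  have hr : LinearMap.range ((pairing k n d M).flip a) = Forms k (M + n) :=
    Submodule.eq_of_le_of_finrank_le (range_pairing_le a M) (by rwa [finrank_forms])
  have hX : ∀ j : Fin 2, g ∣ X j ^ (M + n) := by
    intro j
    have hj : (X j ^ (M + n) : MvPolynomial (Fin 2) k) ∈ Forms k (M + n) :=
      isHomogeneous_X_pow j (M + n)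
    rw [← hr] at hj
    obtain ⟨v, hv⟩ := hj
    rw [← hv, LinearMap.flip_apply, pairing_apply]
    exact Finset.dvd_sum fun i _ => (hg i).mul_left _
  by_contra hu
  have hg0 : g ≠ 0 := by
    rintro rfl
    exact pow_ne_zero _ (X_ne_zero 0) (zero_dvd_iff.1 (hX 0))
  obtain ⟨q, hq, hqg⟩ := WfDvdMonoid.exists_irreducible_factor hu hg0
  have hqp := hq.prime
  have h0 := hqp.dvd_of_dvd_pow (hqg.trans (hX 0))
  have h1 := hqp.dvd_of_dvd_pow (hqg.trans (hX 1))
  have hX0 : Irreducible (X 0 : MvPolynomial (Fin 2) k) := (X_prime (i := 0)).irreducible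
  exact not_X_zero_dvd_X_one ((hq.associated_of_dvd hX0 h0).symm.dvd.trans h1)

/-- The Hilbert function of the syzygy module of a tuple of type `μ`. -/
theorem HasMuType.finrank_ker {a : Fin (d + 1) → Forms k n} {μ : DPartPartition d}
    (h : HasMuType a μ) (M : ℕ) :
    Module.finrank k (LinearMap.ker ((pairing k n d M).flip a)) =
      ∑ j, (M + 1 - μ.parts j) := by
  classical
  obtain ⟨A, hA, hinj, hex⟩ := h
  let W : Fin d → Submodule k (MvPolynomial (Fin 2) k) := fun j =>
    if μ.parts j ≤ M then Forms k (M - μ.parts j) else ⊥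
  have hWle : ∀ j, μ.parts j ≤ M → W j = Forms k (M - μ.parts j) := fun j hj => if_pos hj
  have hWlt : ∀ j, ¬ μ.parts j ≤ M → W j = ⊥ := fun j hj => if_neg hj
  have hWrank : ∀ j, Module.finrank k (W j) = M + 1 - μ.parts j := by
    intro j
    by_cases hj : μ.parts j ≤ M
    · rw [hWle j hj, finrank_forms]; omega
    · rw [hWlt j hj, finrank_bot]; omega
  have hWfin : ∀ j, Module.Finite k (W j) := by
    intro j
    by_cases hj : μ.parts j ≤ M
    · rw [hWle j hj]; infer_instance
    · rw [hWlt j hj]; infer_instance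
  have hhom : ∀ i j (w : W j), (A i j * (w : MvPolynomial (Fin 2) k)).IsHomogeneous M := by
    rintro i j ⟨w, hw⟩
    by_cases hj : μ.parts j ≤ M
    · rw [hWle j hj] at hw
      have := (hA i j).mul hw
      rwa [Nat.add_sub_cancel' hj] at this
    · rw [hWlt j hj, Submodule.mem_bot] at hw
      subst hw
      rw [mul_zero]
      exact isHomogeneous_zero _ _ _
  let T : ((j : Fin d) → W j) →ₗ[k] (Fin (d + 1) → Forms k M) :=
    { toFun := fun w i => ⟨∑ j, A i j * (w j : MvPolynomial (Fin 2) k),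
        IsHomogeneous.sum _ _ _ fun j _ => hhom i j (w j)⟩
      map_add' := fun v w => by
        ext1 i; apply Subtype.ext; simp [mul_add, Finset.sum_add_distrib]
      map_smul' := fun c w => by
        ext1 i; apply Subtype.ext; simp [Finset.smul_sum] }
  have hT : ∀ w i, (T w i : MvPolynomial (Fin 2) k) =
      A.mulVec (fun j => (w j : MvPolynomial (Fin 2) k)) i := fun w i => rfl
  have hTinj : Function.Injective T := by
    intro v w hvw
    have := @hinj (fun j => (v j : MvPolynomial (Fin 2) k)) (fun j => w j) (by
      ext1 i; rw [← hT, ← hT, hvw])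
    ext1 j
    exact Subtype.ext (congrFun this j)
  have hrange : LinearMap.range T = LinearMap.ker ((pairing k n d M).flip a) := by
    apply le_antisymm
    · rintro _ ⟨w, rfl⟩
      exact (hex _).2 ⟨fun j => (w j : MvPolynomial (Fin 2) k), rfl⟩
    · intro v hv
      obtain ⟨w, hw⟩ := (hex fun i => (v i : MvPolynomial (Fin 2) k)).1 hv
      refine ⟨fun j => ⟨if μ.parts j ≤ M then homogeneousComponent (M - μ.parts j) (w j) else 0,
        ?_⟩, ?_⟩
      · by_cases hj : μ.parts j ≤ M
        · rw [hWle j hj, if_pos hj]; exact homogeneousComponent_mem _ _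
        · rw [if_neg hj]; exact zero_mem _
      · ext1 i
        apply Subtype.ext
        rw [hT, ← homogeneousComponent_eq_self (v i).2, ← congrFun hw i]
        simp only [Matrix.mulVec, dotProduct, map_sum]
        refine Finset.sum_congr rfl fun j _ => ?_
        by_cases hj : μ.parts j ≤ M
        · rw [if_pos hj, homogeneousComponent_mul_of_le (hA i j) hj]
        · rw [if_neg hj, homogeneousComponent_mul_of_lt (hA i j) (not_le.1 hj), mul_zero]
  rw [← hrange, LinearMap.finrank_range_of_inj hTinj, Module.finrank_pi_fintype]
  exact Finset.sum_congr rfl fun j _ => hWrank j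

theorem HasMuType.finrank_range_add {a : Fin (d + 1) → Forms k n} {μ : DPartPartition d}
    (h : HasMuType a μ) (M : ℕ) :
    Module.finrank k (LinearMap.range ((pairing k n d M).flip a)) + ∑ j, (M + 1 - μ.parts j) =
      (d + 1) * (M + 1) := by
  rw [← h.finrank_ker, LinearMap.finrank_range_add_finrank_ker, finrank_tuples]

theorem DPartPartition.parts_le_size (μ : DPartPartition d) (j : Fin d) : μ.parts j ≤ μ.size :=
  Finset.single_le_sum (f := μ.parts) (fun _ _ => Nat.zero_le _) (Finset.mem_univ j)

/-- At `M = |μ|` no difference `M + 1 - μ_j` is truncated. Once `|μ| = n`, the value is `dim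
R_(M+n)`, so the ideal contains every form of that degree; this is the open condition that certifies
relative primality. -/
theorem HasMuType.finrank_range_size {a : Fin (d + 1) → Forms k n} {μ : DPartPartition d}
    (h : HasMuType a μ) :
    Module.finrank k (LinearMap.range ((pairing k n d μ.size).flip a)) =
      μ.size + μ.size + 1 := by
  have h1 := h.finrank_range_add μ.size
  have h2 : ∑ j, (μ.size + 1 - μ.parts j) + μ.size = d * (μ.size + 1) := by
    rw [show (∑ j, (μ.size + 1 - μ.parts j)) + μ.size =
      ∑ j, ((μ.size + 1 - μ.parts j) + μ.parts j) by rw [Finset.sum_add_distrib]; rfl]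
    rw [Finset.sum_congr rfl fun j _ => Nat.sub_add_cancel
      ((μ.parts_le_size j).trans (Nat.le_succ _))]
    simp
  nlinarith

theorem ne_zero_of_isUnit {a : Fin (d + 1) → MvPolynomial (Fin 2) k}
    (hco : ∀ g, (∀ i, g ∣ a i) → IsUnit g) : a ≠ 0 := by
  rintro rfl
  exact not_isUnit_zero (hco 0 fun i => dvd_rfl)

/-- The minors of a homogeneous `μ`-basis are a scalar multiple of the tuple, and `|μ| = n`. -/
theorem exists_minors_eq_C_mul {a : Fin (d + 1) → Forms k n} {μ : DPartPartition d}
    (hco : ∀ g : MvPolynomial (Fin 2) k, (∀ i, g ∣ (a i : MvPolynomial (Fin 2) k)) → IsUnit g)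
    {A : Matrix (Fin (d + 1)) (Fin d) (MvPolynomial (Fin 2) k)}
    (hA : ∀ i j, (A i j).IsHomogeneous (μ.parts j)) (hinj : Function.Injective A.mulVec)
    (hex : Function.Exact A.mulVec
      (fun v : Fin (d + 1) → MvPolynomial (Fin 2) k => ∑ i, v i * (a i : MvPolynomial (Fin 2) k))) :
    μ.size = n ∧ ∃ c : k, c ≠ 0 ∧ ∀ l, minors A l = C c * (a l : MvPolynomial (Fin 2) k) := by
  have h0 := ne_zero_of_isUnit hco
  obtain ⟨c, hc, hm⟩ := exists_minors_eq_mul hinj hco h0 (fun j => by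
    have := (hex _).2 ⟨Pi.single j 1, rfl⟩
    simpa using this)
  -- Degrees of minors give `n ≤ |μ|`, while the rank computation inside `R_(|μ|+n)` gives `|μ| ≤
  -- n`; hence `c` is constant.
  have hdeg : c.totalDegree + n = μ.size := by
    obtain ⟨l, hl⟩ := Function.ne_iff.1 h0
    have h1 := isHomogeneous_minors hA l
    have h2 : minors A l ≠ 0 := by rw [hm]; exact mul_ne_zero hc hl
    have h3 := h1.totalDegree h2
    rw [hm, totalDegree_mul_of_isDomain hc hl, (a l).2.totalDegree hl] at h3
    exact h3
  have hle : μ.size ≤ n := by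
    have h1 := HasMuType.finrank_range_size (a := a) (μ := μ) ⟨A, hA, hinj, hex⟩
    have h2 := Submodule.finrank_mono (range_pairing_le a μ.size)
    rw [finrank_forms] at h2
    omega
  refine ⟨by omega, ?_⟩
  have hc0 : c = C (coeff 0 c) := totalDegree_eq_zero_iff_eq_C.1 (by omega)
  refine ⟨coeff 0 c, fun h => hc (by rw [hc0, h, C_0]), fun l => by rw [← hc0, hm]⟩

theorem size_eq_of_mem_stratum {a : ParamSpace k n d} {μ : DPartPartition d}
    (h : a ∈ stratum k n d μ) : μ.size = n := by
  obtain ⟨A, hA, hinj, hex⟩ := h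
  exact (exists_minors_eq_C_mul a.2.2 hA hinj hex).1

/-- Recognizes the type of a deformed tuple from a matrix of the right degrees, without computing
its syzygies. -/
theorem hasMuType_of_minors {b : Fin (d + 1) → Forms k n} {μ : DPartPartition d}
    (hco : ∀ g : MvPolynomial (Fin 2) k, (∀ i, g ∣ (b i : MvPolynomial (Fin 2) k)) → IsUnit g)
    {A : Matrix (Fin (d + 1)) (Fin d) (MvPolynomial (Fin 2) k)}
    (hA : ∀ i j, (A i j).IsHomogeneous (μ.parts j)) {c : k} (hc : c ≠ 0)
    (hm : ∀ l, minors A l = C c * (b l : MvPolynomial (Fin 2) k)) : HasMuType b μ := by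
  have hu : IsUnit (C c : MvPolynomial (Fin 2) k) := (isUnit_iff_ne_zero.2 hc).map C
  have hco' : ∀ g : MvPolynomial (Fin 2) k,
      (∀ i, g ∣ C c * (b i : MvPolynomial (Fin 2) k)) → IsUnit g :=
    fun g hg => hco g fun i => (hu.dvd_mul_left).1 (hg i)
  obtain ⟨h1, h2⟩ := exact_of_minors hco' (ne_zero_of_isUnit hco') hm
  refine ⟨A, hA, h1, fun v => ?_⟩
  rw [← h2 v]
  have : ∑ i, v i * (C c * (b i : MvPolynomial (Fin 2) k)) =
      C c * ∑ i, v i * (b i : MvPolynomial (Fin 2) k) := by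
    rw [Finset.mul_sum]
    exact Finset.sum_congr rfl fun i _ => by ring
  simp only [this, hu.mul_right_eq_zero]

/-- The entries of a tuple of type `μ` are linearly independent. -/
theorem HasMuType.linearIndependent {a : Fin (d + 1) → Forms k n} {μ : DPartPartition d}
    (h : HasMuType a μ) : LinearIndependent k a := by
  obtain ⟨A, hA, -, hex⟩ := h
  rw [Fintype.linearIndependent_iff]
  intro g hg i
  obtain ⟨w, hw⟩ := (hex fun i => C (g i)).1 (by
    have := congrArg (fun f : Forms k n => (f : MvPolynomial (Fin 2) k)) hg
    simpa [smul_eq_C_mul] using this)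
  -- A constant syzygy is a combination of columns of positive degree, so it vanishes at the origin.
  have h1 := congrArg (eval (0 : Fin 2 → k)) (congrFun hw i)
  simp only [Matrix.mulVec, dotProduct, map_sum, map_mul, eval_C] at h1
  rw [← h1]
  refine Finset.sum_eq_zero fun j _ => ?_
  have h2 : eval (0 : Fin 2 → k) (A i j) = 0 := by
    rw [show eval (0 : Fin 2 → k) (A i j) = coeff 0 (A i j) by
      rw [← constantCoeff_eq, ← eval_zero]]
    exact (hA i j).coeff_eq_zero (by have := μ.one_le j; rw [map_zero]; omega)
  rw [h2, zero_mul]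

end Syzygies

/-! ### Bases adapted to a filtration -/

section AdaptedBasis

variable {k V : Type*} [Field k] [AddCommGroup V] [Module k V]

theorem exists_adapted_set {W : ℕ → Submodule k V} (hW : Monotone W) (M : ℕ) :
    ∃ B : Set V, B ⊆ W M ∧ LinearIndepOn k id B ∧
      ∀ m ≤ M, W m ≤ Submodule.span k (B ∩ W m) := by
  induction M with
  | zero =>
    obtain ⟨B, hBt, -, hsp, hli⟩ := exists_linearIndepOn_id_extension
      (linearIndepOn_empty k (id : V → V)) (Set.empty_subset (W 0 : Set V))
    refine ⟨B, hBt, hli, fun m hm => ?_⟩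
    obtain rfl : m = 0 := by omega
    rw [Set.inter_eq_left.2 hBt]
    exact hsp
  | succ M ih =>
    obtain ⟨B, hB, hli, hsp⟩ := ih
    obtain ⟨B', hBt, hBB', hsp', hli'⟩ := exists_linearIndepOn_id_extension hli
      (hB.trans (hW (Nat.le_succ M)))
    refine ⟨B', hBt, hli', fun m hm => ?_⟩
    rcases Nat.lt_or_ge M m with h | h
    · obtain rfl : m = M + 1 := by omega
      rw [Set.inter_eq_left.2 hBt]
      exact hsp'
    · exact (hsp m h).trans (Submodule.span_mono (Set.inter_subset_inter_left _ hBB'))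

/-- A filtration that becomes stationary at a `d`-dimensional space has an adapted basis, sorted
by degree. -/
theorem exists_adapted_basis [FiniteDimensional k V] {W : ℕ → Submodule k V} (hW : Monotone W)
    (h0 : W 0 = ⊥) {N d : ℕ} (hN : ∀ m, W m ≤ W N) (hd : Module.finrank k (W N) = d) :
    ∃ (x : Fin d → V) (p : Fin d → ℕ), Monotone p ∧ (∀ i, 1 ≤ p i) ∧ LinearIndependent k x ∧
      (∀ i, x i ∈ W (p i)) ∧ ∀ m, W m ≤ Submodule.span k (x '' {i | p i ≤ m}) := by
  classical
  obtain ⟨B, hB, hli, hsp⟩ := exists_adapted_set hW N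
  have hli' : LinearIndependent k (Subtype.val : B → V) := hli
  have : Finite B := hli'.finite
  let := Fintype.ofFinite B
  have hspan : Submodule.span k (Set.range (Subtype.val : B → V)) = W N := by
    rw [Subtype.range_coe]
    apply le_antisymm (Submodule.span_le.2 hB)
    exact (hsp N le_rfl).trans (Submodule.span_mono Set.inter_subset_left)
  have hcard : Fintype.card B = d := by
    rw [← hd, ← hspan, finrank_span_eq_card hli']
  let e : Fin d ≃ B := (Fintype.equivFinOfCardEq hcard).symm
  have hex : ∀ b : B, ∃ m, (b : V) ∈ W m := fun b => ⟨N, hB b.2⟩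
  -- The degree of a basis vector is the first filtration step containing it; it is positive because
  -- `W 0 = ⊥`.
  let deg : B → ℕ := fun b => Nat.find (hex b)
  let σ := Tuple.sort (deg ∘ e)
  refine ⟨fun i => e (σ i), fun i => deg (e (σ i)), Tuple.monotone_sort (deg ∘ e), fun i => ?_,
    hli'.comp (fun i => e (σ i)) (e.injective.comp σ.injective),
    fun i => Nat.find_spec (hex (e (σ i))), fun m => ?_⟩
  · by_contra hlt
    have h1 := Nat.find_spec (hex (e (σ i)))
    rw [show Nat.find (hex (e (σ i))) = 0 by change ¬ 1 ≤ Nat.find _ at hlt; omega, h0,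
      Submodule.mem_bot] at h1
    exact hli'.ne_zero _ h1
  · have hstep : ∀ m, m ≤ N →
        W m ≤ Submodule.span k ((fun i => (e (σ i) : V)) '' {i | deg (e (σ i)) ≤ m}) := by
      intro m hm
      refine (hsp m hm).trans (Submodule.span_mono ?_)
      rintro b ⟨hb, hbm⟩
      refine ⟨σ.symm (e.symm ⟨b, hb⟩), ?_, by simp⟩
      simp only [Set.mem_ofPred_eq, Equiv.apply_symm_apply]
      exact Nat.find_min' _ hbm
    rcases le_total m N with h | h
    · exact hstep m h
    · refine (hN m).trans ((hstep N le_rfl).trans (Submodule.span_mono (Set.image_mono ?_)))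
      exact fun i (hi : _ ≤ N) => le_trans hi h

end AdaptedBasis

/-! ### Existence of `μ`-bases from values of syzygies at `(0, 1)` -/

section MuBasis

variable {k : Type*} [Field k] {n d : ℕ}

/-- The values at `(0, 1)` of the syzygies of degree `M`. -/
noncomputable def syzygyValues (a : Fin (d + 1) → Forms k n) (M : ℕ) :
    Submodule k (Fin (d + 1) → k) where
  carrier := {x | ∃ v : Fin (d + 1) → MvPolynomial (Fin 2) k, (∀ i, (v i).IsHomogeneous M) ∧
    ∑ i, v i * (a i : MvPolynomial (Fin 2) k) = 0 ∧ ∀ i, eval (basePt k) (v i) = x i}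
  add_mem' := by
    rintro x y ⟨v, hv, hva, hvx⟩ ⟨w, hw, hwa, hwy⟩
    refine ⟨v + w, fun i => (hv i).add (hw i), ?_, fun i => by simp [hvx, hwy]⟩
    simp [add_mul, Finset.sum_add_distrib, hva, hwa]
  zero_mem' := ⟨0, fun i => isHomogeneous_zero _ _ _, by simp, by simp⟩
  smul_mem' := by
    rintro c x ⟨v, hv, hva, hvx⟩
    refine ⟨fun i => C c * v i, fun i => (hv i).C_mul c, ?_, fun i => by simp [hvx]⟩
    simp only [mul_assoc, ← Finset.mul_sum, hva, mul_zero]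

theorem isHomogeneous_X_pow_mul {M N : ℕ} (h : M ≤ N) {f : MvPolynomial (Fin 2) k}
    (hf : f.IsHomogeneous M) (j : Fin 2) : (X j ^ (N - M) * f).IsHomogeneous N := by
  have := (isHomogeneous_X_pow (R := k) j (N - M)).mul hf
  rwa [Nat.sub_add_cancel h] at this

/-- Multiplication by a power of `t` raises the degree and preserves values, since `t = 1` at the
base point. -/
theorem syzygyValues_mono (a : Fin (d + 1) → Forms k n) : Monotone (syzygyValues a) := by
  rintro M N hMN x ⟨v, hv, hva, hvx⟩
  refine ⟨fun i => X 1 ^ (N - M) * v i, fun i => isHomogeneous_X_pow_mul hMN (hv i) 1, ?_,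
    fun i => by simp [basePt, ← hvx]⟩
  simp only [mul_assoc, ← Finset.mul_sum, hva, mul_zero]

theorem syzygyValues_zero {a : Fin (d + 1) → Forms k n} (ha : LinearIndependent k a) :
    syzygyValues a 0 = ⊥ := by
  rw [eq_bot_iff]
  rintro x ⟨v, hv, hva, hvx⟩
  have hC : ∀ i, v i = C (x i) := by
    intro i
    obtain ⟨c, hc⟩ : ∃ c, v i = C c :=
      ⟨_, totalDegree_eq_zero_iff_eq_C.1 (Nat.le_zero.1 (hv i).totalDegree_le)⟩
    rw [hc, ← hvx, hc, eval_C]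
  rw [Submodule.mem_bot]
  ext i
  refine Fintype.linearIndependent_iff.1 ha x (Subtype.ext ?_) i
  simpa [hC, smul_eq_C_mul] using hva

theorem exists_eval_ne_zero {a : Fin (d + 1) → Forms k n}
    (hco : ∀ g : MvPolynomial (Fin 2) k, (∀ i, g ∣ (a i : MvPolynomial (Fin 2) k)) → IsUnit g) :
    ∃ i, eval (basePt k) (a i : MvPolynomial (Fin 2) k) ≠ 0 := by
  by_contra hcon
  push Not at hcon
  refine X_prime.not_isUnit (hco (X 0) fun i => ?_)
  obtain ⟨u, -, hu⟩ := exists_eq_X_mul (a i).2 (hcon i)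
  exact ⟨u, hu⟩

/-- In large degrees the values of syzygies at `(0, 1)` fill the hyperplane orthogonal to the
value of `a`. -/
theorem mem_syzygyValues_iff {a : Fin (d + 1) → Forms k n}
    (hco : ∀ g : MvPolynomial (Fin 2) k, (∀ i, g ∣ (a i : MvPolynomial (Fin 2) k)) → IsUnit g)
    {x : Fin (d + 1) → k} :
    x ∈ syzygyValues a n ↔ ∑ i, x i * eval (basePt k) (a i : MvPolynomial (Fin 2) k) = 0 := by
  constructor
  · rintro ⟨v, hv, hva, hvx⟩
    have := congrArg (eval (basePt k)) hva
    simpa [hvx] using this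
  · intro hx
    obtain ⟨i₀, hi₀⟩ := exists_eval_ne_zero hco
    set α := eval (basePt k) (a i₀ : MvPolynomial (Fin 2) k) with hα
    let S : MvPolynomial (Fin 2) k := ∑ l, C (x l) * (a l : MvPolynomial (Fin 2) k)
    have hS : S.IsHomogeneous n := IsHomogeneous.sum _ _ _ fun l _ => (a l).2.C_mul _
    have hSe : eval (basePt k) S = 0 := by simpa [S] using hx
    -- A combination of Koszul syzygies of degree `n`: its pairing with `a` is `α⁻¹ (S a_(i₀) - S
    -- a_(i₀))`, and its value is `x` because `S` vanishes at the base point.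
    refine ⟨fun j => C α⁻¹ * (C (x j) * (a i₀ : MvPolynomial (Fin 2) k) - if j = i₀ then S else 0), fun j => ?_, ?_,
      fun j => ?_⟩
    · refine (((a i₀).2.C_mul _).sub ?_).C_mul _
      split_ifs
      · exact hS
      · exact isHomogeneous_zero _ _ _
    · simp only [mul_assoc, ← Finset.mul_sum, sub_mul, Finset.sum_sub_distrib, ite_mul, zero_mul,
        Finset.sum_ite_eq', Finset.mem_univ, if_true]
      have : ∑ j, C (x j) * ((a i₀ : MvPolynomial (Fin 2) k) * (a j : MvPolynomial (Fin 2) k)) =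
          S * (a i₀ : MvPolynomial (Fin 2) k) := by
        rw [Finset.sum_mul]
        exact Finset.sum_congr rfl fun l _ => by ring
      rw [this, sub_self, mul_zero]
    · have : eval (basePt k) (if j = i₀ then S else 0) = 0 := by
        split_ifs
        · exact hSe
        · simp
      simp only [map_mul, map_sub, eval_C, this, ← hα]
      field_simp
      ring

theorem finrank_syzygyValues {a : Fin (d + 1) → Forms k n}
    (hco : ∀ g : MvPolynomial (Fin 2) k, (∀ i, g ∣ (a i : MvPolynomial (Fin 2) k)) → IsUnit g) :
    Module.finrank k (syzygyValues a n) = d := by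
  classical
  let L : (Fin (d + 1) → k) →ₗ[k] k :=
    Fintype.linearCombination k fun i => eval (basePt k) (a i : MvPolynomial (Fin 2) k)
  have hL : syzygyValues a n = LinearMap.ker L := by
    ext x
    rw [mem_syzygyValues_iff hco, LinearMap.mem_ker, Fintype.linearCombination_apply]
    rfl
  have hsurj : LinearMap.range L = ⊤ := by
    obtain ⟨i, hi⟩ := exists_eval_ne_zero hco
    refine LinearMap.range_eq_top.2 (LinearMap.surjective fun h => hi ?_)
    have := LinearMap.congr_fun h (Pi.single i 1)
    simpa [L] using this
  have := LinearMap.finrank_range_add_finrank_ker L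
  rw [hsurj, finrank_top, ← hL] at this
  simp at this
  omega

theorem syzygyValues_le {a : Fin (d + 1) → Forms k n}
    (hco : ∀ g : MvPolynomial (Fin 2) k, (∀ i, g ∣ (a i : MvPolynomial (Fin 2) k)) → IsUnit g)
    (M : ℕ) : syzygyValues a M ≤ syzygyValues a n := by
  rintro x ⟨v, hv, hva, hvx⟩
  rw [mem_syzygyValues_iff hco]
  have := congrArg (eval (basePt k)) hva
  simpa [hvx] using this

/-- Existence of `μ`-bases. -/
theorem exists_hasMuType (a : ParamSpace k n d) : ∃ μ : DPartPartition d, a ∈ stratum k n d μ := by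
  classical
  obtain ⟨a, hli, hco⟩ := a
  obtain ⟨x, p, hp, hp1, hx, hxW, hspan⟩ := exists_adapted_basis (syzygyValues_mono a)
    (syzygyValues_zero hli) (syzygyValues_le hco) (finrank_syzygyValues hco)
  choose V hV hVa hVx using hxW
  let A : Matrix (Fin (d + 1)) (Fin d) (MvPolynomial (Fin 2) k) := Matrix.of fun i j => V j i
  have hAa : ∀ w, ∑ i, A.mulVec w i * (a i : MvPolynomial (Fin 2) k) = 0 := by
    intro w
    simp only [Matrix.mulVec, dotProduct, Finset.sum_mul]
    rw [Finset.sum_comm]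
    refine Finset.sum_eq_zero fun j _ => ?_
    calc ∑ i, A i j * w j * (a i : MvPolynomial (Fin 2) k)
        = w j * ∑ i, V j i * (a i : MvPolynomial (Fin 2) k) := by
          rw [Finset.mul_sum]
          exact Finset.sum_congr rfl fun i _ => by simp only [A, Matrix.of_apply]; ring
      _ = 0 := by rw [hVa, mul_zero]
  -- Induction on degree: subtract a combination of columns with the same value at `(0, 1)`; the
  -- difference is `s` times a syzygy of degree one less.
  have hgen : ∀ (M : ℕ) (v : Fin (d + 1) → MvPolynomial (Fin 2) k),
      (∀ i, (v i).IsHomogeneous M) → ∑ i, v i * (a i : MvPolynomial (Fin 2) k) = 0 →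
      ∃ w, A.mulVec w = v := by
    intro M
    induction M with
    | zero =>
      intro v hv hva
      have h1 : (fun i => eval (basePt k) (v i)) ∈ syzygyValues a 0 :=
        ⟨v, hv, hva, fun i => rfl⟩
      rw [syzygyValues_zero hli, Submodule.mem_bot] at h1
      refine ⟨0, ?_⟩
      rw [Matrix.mulVec_zero]
      ext1 i
      rw [totalDegree_eq_zero_iff_eq_C.1 (Nat.le_zero.1 (hv i).totalDegree_le)]
      have h2 := congrFun h1 i
      rw [totalDegree_eq_zero_iff_eq_C.1 (Nat.le_zero.1 (hv i).totalDegree_le), eval_C] at h2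
      rw [h2]
      simp
    | succ M ih =>
      intro v hv hva
      have h1 : (fun i => eval (basePt k) (v i)) ∈ syzygyValues a (M + 1) :=
        ⟨v, hv, hva, fun i => rfl⟩
      have h2 := hspan _ h1
      rw [Finsupp.mem_span_image_iff_linearCombination] at h2
      obtain ⟨c, hcs, hc⟩ := h2
      have hc0 : ∀ j, ¬ p j ≤ M + 1 → c j = 0 := fun j hj =>
        Finsupp.notMem_support_iff.1 fun h => hj (hcs h)
      -- The truncated exponent is harmless, since `c j = 0` whenever `p j > M + 1`.
      let w₀ : Fin d → MvPolynomial (Fin 2) k := fun j => C (c j) * X 1 ^ (M + 1 - p j)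
      have hw₀hom : ∀ i, (A.mulVec w₀ i).IsHomogeneous (M + 1) := by
        intro i
        refine IsHomogeneous.sum _ _ _ fun j _ => ?_
        by_cases hj : p j ≤ M + 1
        · convert (isHomogeneous_X_pow_mul hj (hV j i) 1).C_mul (c j) using 1
          simp only [A, w₀, Matrix.of_apply]
          ring
        · simp only [w₀, hc0 j hj, C_0, zero_mul, mul_zero]
          exact isHomogeneous_zero _ _ _
      have hw₀eval : ∀ i, eval (basePt k) (A.mulVec w₀ i) = eval (basePt k) (v i) := by
        intro i
        have h4 := congrFun hc i
        rw [Finsupp.linearCombination_apply, Finsupp.sum_fintype _ _ (by simp)] at h4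
        simp only [Finset.sum_apply, Pi.smul_apply, smul_eq_mul] at h4
        rw [← h4]
        have h5 : eval (basePt k) (X 1) = 1 := by simp [basePt]
        simp [Matrix.mulVec, dotProduct, A, w₀, hVx, h5, mul_comm]
      have hdiv : ∀ i, ∃ u : MvPolynomial (Fin 2) k, u.IsHomogeneous M ∧
          v i - A.mulVec w₀ i = X 0 * u := fun i =>
        exists_eq_X_mul ((hv i).sub (hw₀hom i)) (by rw [map_sub, hw₀eval, sub_self])
      choose u hu huv using hdiv
      obtain ⟨w₁, hw₁⟩ := ih u hu (by
        refine (mul_eq_zero.1 (?_ : (X 0 : MvPolynomial (Fin 2) k) * _ = 0)).resolve_left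
          (X_ne_zero 0)
        rw [Finset.mul_sum]
        simp only [← mul_assoc, ← huv, sub_mul, Finset.sum_sub_distrib, hva, hAa, sub_self])
      refine ⟨w₀ + (X 0 : MvPolynomial (Fin 2) k) • w₁, ?_⟩
      rw [Matrix.mulVec_add, Matrix.mulVec_smul, hw₁]
      ext1 i
      simp only [Pi.add_apply, Pi.smul_apply, smul_eq_mul, ← huv]
      ring
  refine ⟨⟨p, hp1, hp⟩, A, fun i j => hV j i, ?_, fun v => ⟨fun hv => ?_, ?_⟩⟩
  -- Injectivity: at the base point the columns become the independent vectors `x`, so some minor is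
  -- already nonzero there.
  · have h1 : (A.map (eval (basePt k))).col = x := by
      ext j i
      exact hVx j i
    obtain ⟨l, hl⟩ := exists_minors_ne_zero_of_field (by rw [h1]; exact hx)
    rw [minors_map] at hl
    exact mulVec_injective_of_minors_ne_zero (l := l) fun h => hl (by rw [h, map_zero])
  · have hcomp : ∀ M, ∑ i, homogeneousComponent M (v i) * (a i : MvPolynomial (Fin 2) k) = 0 := by
      intro M
      have h1 := congrArg (homogeneousComponent (n + M)) hv
      simp only [map_sum, map_zero] at h1
      rw [← h1]
      refine Finset.sum_congr rfl fun i _ => ?_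
      rw [mul_comm (v i), homogeneousComponent_mul_of_le (a i).2 (Nat.le_add_right _ _),
        Nat.add_sub_cancel_left, mul_comm]
    choose w hw using fun M => hgen M (fun i => homogeneousComponent M (v i))
      (fun i => homogeneousComponent_isHomogeneous _ _) (hcomp M)
    let N := Finset.univ.sup fun i => (v i).totalDegree
    refine ⟨∑ M ∈ Finset.range (N + 1), w M, ?_⟩
    ext1 i
    have h1 : v i = ∑ M ∈ Finset.range (N + 1), homogeneousComponent M (v i) := by
      conv_lhs => rw [← sum_homogeneousComponent (v i)]
      refine Finset.sum_subset (Finset.range_mono ?_) fun M _ hM => ?_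
      · exact Nat.succ_le_succ (Finset.le_sup (f := fun i => (v i).totalDegree)
          (Finset.mem_univ i))
      · exact homogeneousComponent_eq_zero _ _ (by simpa using hM)
    rw [h1]
    have h2 : A.mulVec (∑ M ∈ Finset.range (N + 1), w M) =
        ∑ M ∈ Finset.range (N + 1), A.mulVec (w M) :=
      map_sum A.mulVecLin w _
    rw [h2, Finset.sum_apply]
    exact Finset.sum_congr rfl fun M _ => congrFun (hw M) i
  · rintro ⟨w, rfl⟩
    exact hAa w

end MuBasis

/-! ### Semicontinuity of the type -/

section Semicontinuity

variable {k : Type*} [Field k] {n d : ℕ}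

theorem le_of_forall_sum_tsub_le {μ' μ : DPartPartition d}
    (h : ∀ M, ∑ j, (M + 1 - μ.parts j) ≤ ∑ j, (M + 1 - μ'.parts j)) : μ' ≤ μ := by
  intro j
  -- The test degree is `M = μ'_j - 1`: by monotonicity, exactly at this threshold the sum for `μ'`
  -- equals its untruncated part over `i ≤ j`, while truncation only increases the sum for `μ`.
  obtain ⟨c, hc⟩ : ∃ c, μ'.parts j = c + 1 := ⟨_, (Nat.sub_add_cancel (μ'.one_le j)).symm⟩
  have h1 : ∑ i, (c + 1 - μ'.parts i) = ∑ i ∈ Finset.Iic j, (c + 1 - μ'.parts i) := by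
    symm
    refine Finset.sum_subset (Finset.subset_univ _) fun i _ hi => ?_
    have := μ'.mono (not_le.1 fun hij => hi (Finset.mem_Iic.2 hij)).le
    omega
  have h2 : ∑ i ∈ Finset.Iic j, (c + 1 - μ.parts i) ≤ ∑ i, (c + 1 - μ.parts i) :=
    Finset.sum_le_sum_of_subset (Finset.subset_univ _)
  have h3 : ∑ i ∈ Finset.Iic j, (c + 1 - μ'.parts i) + ∑ i ∈ Finset.Iic j, μ'.parts i =
      ∑ i ∈ Finset.Iic j, (c + 1) := by
    rw [← Finset.sum_add_distrib]
    refine Finset.sum_congr rfl fun i hi => ?_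
    have := μ'.mono (Finset.mem_Iic.1 hi)
    omega
  have h4 : ∑ i ∈ Finset.Iic j, (c + 1) ≤
      ∑ i ∈ Finset.Iic j, (c + 1 - μ.parts i) + ∑ i ∈ Finset.Iic j, μ.parts i := by
    rw [← Finset.sum_add_distrib]
    exact Finset.sum_le_sum fun i _ => by omega
  have := h c
  omega

theorem le_of_mem_closure {μ μ' : DPartPartition d} {a : ParamSpace k n d}
    (ha : a ∈ closure (stratum k n d μ)) (h : a ∈ stratum k n d μ') : μ' ≤ μ := by
  refine le_of_forall_sum_tsub_le fun M => ?_
  obtain ⟨f, hf, hf'⟩ := exists_poly_finrank_range_le a.1 M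
  obtain ⟨b, hb, hfb⟩ := exists_of_mem_closure ha hf
  have h1 := hf' _ hfb
  have h2 := HasMuType.finrank_range_add h M
  have h3 := HasMuType.finrank_range_add hb M
  omega

end Semicontinuity

/-! ### Deforming a `μ`-basis along a line -/

section Deformation

/-- As a function of columns `i` and `j` the determinant is bilinear and alternating: the `x y` term
dies, and the two mixed terms combine to `D a (x • u + y • v)`. -/
theorem det_updateCol_updateCol_pencil {R ι : Type*} [CommRing R] [Fintype ι] [DecidableEq ι]
    (B : Matrix ι ι R) {i j : ι} (hij : i ≠ j) (a u v : ι → R) (c x y : R) :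
    ((B.updateCol i (c • v + x • a)).updateCol j (c • u - y • a)).det =
      c * (((B.updateCol i a).updateCol j (x • u + y • v)).det +
        c * ((B.updateCol i v).updateCol j u).det) := by
  let D : (ι → R) → (ι → R) → R := fun f g => ((B.updateCol i f).updateCol j g).det
  have hadd : ∀ f g h, D f (g + h) = D f g + D f h := fun f g h => Matrix.det_updateCol_add _ _ _ _
  have hsmul : ∀ f r g, D f (r • g) = r * D f g := fun f r g => Matrix.det_updateCol_smul _ _ _ _
  have hadd' : ∀ f g h, D (f + g) h = D f h + D g h := fun f g h => by
    simp only [D, Matrix.updateCol_comm _ hij, Matrix.det_updateCol_add]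
  have hsmul' : ∀ r f g, D (r • f) g = r * D f g := fun r f g => by
    simp only [D, Matrix.updateCol_comm _ hij, Matrix.det_updateCol_smul]
  have hself : ∀ f, D f f = 0 := fun f =>
    Matrix.det_zero_of_column_eq hij fun l => by simp [hij]
  have hswap : D v a = -D a v := by
    have := hself (v + a)
    rw [hadd, hadd', hadd', hself, hself] at this
    linear_combination this
  change D (c • v + x • a) (c • u - y • a) = c * (D a (x • u + y • v) + c * D v u)
  rw [sub_eq_add_neg, ← neg_smul]
  simp only [hadd, hadd', hsmul, hsmul', hself, hswap]
  ring

theorem minors_updateCol_updateCol_pencil {R : Type*} [CommRing R] {d : ℕ}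
    (A : Matrix (Fin (d + 1)) (Fin d) R) {i j : Fin d} (hij : i ≠ j) {u v : Fin (d + 1) → R}
    {x y : R} (h : ∀ l, A l j = x * u l + y * v l) (c : R) (l : Fin (d + 1)) :
    minors ((A.updateCol i (c • v + x • fun l => A l i)).updateCol j
        (c • u - y • fun l => A l i)) l =
      c * (minors A l + c * minors ((A.updateCol i v).updateCol j u) l) := by
  have hsub : ∀ f g : Fin (d + 1) → R, ((A.updateCol i f).updateCol j g).submatrix l.succAbove id =
      ((A.submatrix l.succAbove id).updateCol i (f ∘ l.succAbove)).updateCol j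
        (g ∘ l.succAbove) := by
    intro f g
    ext m m'
    simp [Matrix.updateCol_apply]
  have hA : A = (A.updateCol i fun l => A l i).updateCol j (x • u + y • v) := by
    ext m m'
    by_cases hj : m' = j
    · subst hj; simp [h]
    · by_cases hi : m' = i
      · subst hi; simp [hij]
      · simp [hj]
  have key := det_updateCol_updateCol_pencil (A.submatrix l.succAbove id) hij
    ((fun l => A l i) ∘ l.succAbove) (u ∘ l.succAbove) (v ∘ l.succAbove) c x y
  have hA' : minors A l = (-1) ^ (l : ℕ) *
      (((A.submatrix l.succAbove id).updateCol i ((fun l => A l i) ∘ l.succAbove)).updateCol j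
        (x • (u ∘ l.succAbove) + y • (v ∘ l.succAbove))).det := by
    conv_lhs => rw [hA]
    rw [minors, hsub]
    rfl
  rw [hA', minors, minors, hsub, hsub]
  have e1 : (c • v + x • fun l => A l i) ∘ l.succAbove =
    c • (v ∘ l.succAbove) + x • ((fun l => A l i) ∘ l.succAbove) := rfl
  have e2 : (c • u - y • fun l => A l i) ∘ l.succAbove =
    c • (u ∘ l.succAbove) - y • ((fun l => A l i) ∘ l.succAbove) := rfl
  rw [e1, e2, key]
  ring

/-- On a line through a point off a hypersurface, some other point is off the hypersurface. -/
theorem exists_eval_add_smul_ne_zero {k σ : Type*} [Field k] [Infinite k] {F : MvPolynomial σ k}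
    {x y : σ → k} (h : eval x F ≠ 0) : ∃ τ : k, τ ≠ 0 ∧ eval (x + τ • y) F ≠ 0 := by
  let G : Polynomial k := aeval (fun p => Polynomial.C (x p) + Polynomial.C (y p) * Polynomial.X) F
  have hG : ∀ τ, G.eval τ = eval (x + τ • y) F := by
    intro τ
    have : (Polynomial.evalRingHom τ).comp
        ((aeval (fun p => Polynomial.C (x p) + Polynomial.C (y p) * Polynomial.X) :
          MvPolynomial σ k →ₐ[k] Polynomial k) : MvPolynomial σ k →+* Polynomial k) =
        eval (x + τ • y) := by
      apply MvPolynomial.ringHom_ext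
      · intro r; simp
      · intro p; simp [mul_comm τ]
    exact congrArg (fun φ : MvPolynomial σ k →+* k => φ F) this
  have hG0 : G ≠ 0 := by
    intro h0
    have := hG 0
    rw [h0, Polynomial.eval_zero, zero_smul, add_zero] at this
    exact h this.symm
  by_contra hcon
  push Not at hcon
  -- If `G` vanished at every `τ ≠ 0`, then `X * G` would vanish on the whole infinite field.
  refine mul_ne_zero Polynomial.X_ne_zero hG0 (Polynomial.funext fun τ => ?_)
  rw [Polynomial.eval_mul, Polynomial.eval_X, Polynomial.eval_zero, hG]
  by_cases hτ : τ = 0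
  · rw [hτ, zero_mul]
  · rw [hcon τ hτ, mul_zero]

variable {k : Type*} [Field k] {n d : ℕ}

theorem isHomogeneous_updateCol {A : Matrix (Fin (d + 1)) (Fin d) (MvPolynomial (Fin 2) k)}
    {p p' : Fin d → ℕ} {i j : Fin d} (hA : ∀ l m, (A l m).IsHomogeneous (p m))
    (hp : ∀ m, m ≠ i → m ≠ j → p' m = p m) {f g : Fin (d + 1) → MvPolynomial (Fin 2) k}
    (hf : ∀ l, (f l).IsHomogeneous (p' i)) (hg : ∀ l, (g l).IsHomogeneous (p' j))
    (l : Fin (d + 1)) (m : Fin d) :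
    (((A.updateCol i f).updateCol j g) l m).IsHomogeneous (p' m) := by
  rw [Matrix.updateCol_apply]
  split_ifs with hj
  · rw [hj]; exact hg l
  · rw [Matrix.updateCol_apply]
    split_ifs with hi
    · rw [hi]; exact hf l
    · rw [hp m hi hj]; exact hA l m

/-- Moving two parts towards each other by one gives a stratum having the original one in its
closure. -/
theorem stratum_subset_closure_of_move [Infinite k] {μ' μ'' : DPartPartition d} {i j : Fin d} (hij : i ≠ j)
    (hgap : μ'.parts i + 2 ≤ μ'.parts j) (hi : μ''.parts i = μ'.parts i + 1)
    (hj : μ''.parts j = μ'.parts j - 1) (hrest : ∀ m, m ≠ i → m ≠ j → μ''.parts m = μ'.parts m)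
    (hsize : μ''.size = μ'.size) :
    stratum k n d μ' ⊆ closure (stratum k n d μ'') := by
  intro a ha
  have hn : μ'.size = n := size_eq_of_mem_stratum ha
  have htype : HasMuType a.1 μ' := ha
  obtain ⟨A, hA, hinj, hex⟩ := ha
  obtain ⟨-, c₀, hc₀, hm⟩ := exists_minors_eq_C_mul a.2.2 hA hinj hex
  choose u γ hu hγ using fun l => exists_eq_X_mul_add (hA l j)
  -- Only the `t^(μ'_j)` term of column `j` is not divisible by `s`; it splits as `t^e v`, with `v`
  -- of the new degree `μ'_i + 1`.
  let v : Fin (d + 1) → MvPolynomial (Fin 2) k := fun l => C (γ l) * X 1 ^ (μ'.parts i + 1)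
  let e := μ'.parts j - (μ'.parts i + 1)
  have hsplit : ∀ l, A l j = X 0 * u l + X 1 ^ e * v l := by
    intro l
    rw [hγ l]
    simp only [v, e]
    nth_rewrite 1 [← Nat.sub_add_cancel (show μ'.parts i + 1 ≤ μ'.parts j by omega)]
    rw [pow_add]
    ring
  have hv : ∀ l, (v l).IsHomogeneous (μ''.parts i) := fun l => by
    rw [hi]; exact isHomogeneous_C_mul_X_pow _ _ _
  have hu' : ∀ l, (u l).IsHomogeneous (μ''.parts j) := fun l => by rw [hj]; exact hu l
  have hEhom : ∀ l, (minors ((A.updateCol i v).updateCol j u) l).IsHomogeneous n := by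
    intro l
    have h1 := isHomogeneous_minors (isHomogeneous_updateCol hA hrest hv hu') l
    rwa [show ∑ m, μ''.parts m = n from hsize.trans hn] at h1
  let E : Fin (d + 1) → Forms k n := fun l => ⟨_, hEhom l⟩
  refine mem_closure_of_poly fun f hf => ?_
  -- Nonvanishing of `g` keeps the rank full in degree `|μ'|`, hence the deformed tuple relatively
  -- prime; `f` and `g` are avoided together.
  obtain ⟨g, hg, hg'⟩ := exists_poly_finrank_range_le a.1 μ'.size
  obtain ⟨τ, hτ, hτfg⟩ := exists_eval_add_smul_ne_zero (F := f * g) (x := coords k n d a.1)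
    (y := coords k n d E) (by rw [map_mul]; exact mul_ne_zero hf hg)
  have hcoords : coords k n d (a.1 + τ • E) = coords k n d a.1 + τ • coords k n d E := by
    ext p
    simp [coords]
  rw [← hcoords, map_mul] at hτfg
  have hco : ∀ q : MvPolynomial (Fin 2) k,
      (∀ l, q ∣ (((a.1 + τ • E) l : Forms k n) : MvPolynomial (Fin 2) k)) → IsUnit q := by
    intro q hq
    refine isUnit_of_finrank_range (M := μ'.size) (le_trans ?_
      (hg' _ (right_ne_zero_of_mul hτfg))) hq
    rw [htype.finrank_range_size, hn]
  -- With this `c` the new minors are `c (c₀ a + c E) = c c₀ (a + τ E)`.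
  let c : k := c₀ * τ
  have hb : HasMuType (a.1 + τ • E) μ'' := by
    refine hasMuType_of_minors hco (A := (A.updateCol i
      ((C c : MvPolynomial (Fin 2) k) • v + (X 0 : MvPolynomial (Fin 2) k) • fun l => A l i)).updateCol
      j ((C c : MvPolynomial (Fin 2) k) • u - (X 1 ^ e : MvPolynomial (Fin 2) k) • fun l => A l i))
      (isHomogeneous_updateCol hA hrest (fun l => ?_) fun l => ?_) (c := c * c₀)
      (mul_ne_zero (mul_ne_zero hc₀ hτ) hc₀) fun l => ?_
    · refine ((hv l).C_mul c).add ?_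
      have := (isHomogeneous_X k (0 : Fin 2)).mul (hA l i)
      rwa [add_comm, ← hi] at this
    · refine ((hu' l).C_mul c).sub ?_
      have := (isHomogeneous_X_pow (R := k) (1 : Fin 2) e).mul (hA l i)
      rwa [show e + μ'.parts i = μ''.parts j by simp only [e]; omega] at this
    · rw [minors_updateCol_updateCol_pencil A hij hsplit, hm]
      simp only [c, E, Pi.add_apply, Pi.smul_apply, Submodule.coe_add, Submodule.coe_smul,
        smul_eq_C_mul, C_mul]
      ring
  exact ⟨⟨a.1 + τ • E, hb.linearIndependent, hco⟩, hb, left_ne_zero_of_mul hτfg⟩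

end Deformation

/-! ### Dominance order and elementary moves -/

section Dominance

variable {d : ℕ}

theorem DPartPartition.ext_parts {μ ν : DPartPartition d} (h : μ.parts = ν.parts) : μ = ν := by
  cases μ; cases ν; cases h; rfl

/-- Moving one unit from position `j` to position `i`. -/
theorem sum_eq_of_move {f g : Fin d → ℕ} {i j : Fin d} (hi : g i = f i + 1)
    (hj : g j + 1 = f j) (hrest : ∀ m, m ≠ i → m ≠ j → g m = f m) (s : Finset (Fin d)) :
    ∑ m ∈ s, g m + (if j ∈ s then 1 else 0) = ∑ m ∈ s, f m + (if i ∈ s then 1 else 0) := by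
  rw [← Finset.sum_ite_eq' s j (fun _ => 1), ← Finset.sum_ite_eq' s i (fun _ => 1),
    ← Finset.sum_add_distrib, ← Finset.sum_add_distrib]
  refine Finset.sum_congr rfl fun m _ => ?_
  by_cases hmi : m = i <;> by_cases hmj : m = j
  · subst hmi; subst hmj; omega
  · subst hmi; simp [hmj, hi]
  · subst hmj; simp [hmi, hj]
  · simp [hmi, hmj, hrest m hmi hmj]

theorem sum_Iio_lt {f g : Fin d → ℕ} {i j : Fin d} (hij : i < j)
    (h : ∀ l, i ≤ l → l < j → ∑ m ∈ Finset.Iic l, f m < ∑ m ∈ Finset.Iic l, g m) :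
    ∑ m ∈ Finset.Iio j, f m < ∑ m ∈ Finset.Iio j, g m := by
  have hi : (i : ℕ) < j := hij
  have hlt : (j : ℕ) - 1 < d := by omega
  have hI : Finset.Iio j = Finset.Iic ⟨(j : ℕ) - 1, hlt⟩ := by
    ext m
    simp only [Finset.mem_Iio, Finset.mem_Iic, Fin.lt_def, Fin.le_def]
    omega
  rw [hI]
  exact h _ (by simp only [Fin.le_def]; omega) (by simp only [Fin.lt_def]; omega)

theorem sum_Iic_eq (f : Fin d → ℕ) (j : Fin d) :
    ∑ m ∈ Finset.Iic j, f m = ∑ m ∈ Finset.Iio j, f m + f j := by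
  rw [← Finset.Iio_insert, Finset.sum_insert (by simp), add_comm]

/-- A partition strictly below `μ` can be moved one step up, staying below `μ`. -/
theorem exists_move {μ' μ : DPartPartition d} (hle : μ' ≤ μ) (hs : μ'.size = μ.size)
    (hne : μ' ≠ μ) : ∃ (ν : DPartPartition d) (i j : Fin d), i < j ∧
      μ'.parts i + 2 ≤ μ'.parts j ∧ ν.parts i = μ'.parts i + 1 ∧ ν.parts j = μ'.parts j - 1 ∧
      (∀ m, m ≠ i → m ≠ j → ν.parts m = μ'.parts m) ∧ ν ≤ μ := by
  classical
  obtain ⟨i₀, hi₀, hi₀min⟩ : ∃ i, μ'.parts i ≠ μ.parts i ∧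
      ∀ m < i, μ'.parts m = μ.parts m := by
    have hex : ∃ i, μ'.parts i ≠ μ.parts i := by
      by_contra hcon
      push Not at hcon
      exact hne (DPartPartition.ext_parts (funext hcon))
    obtain ⟨i, hi, hmin⟩ := WellFounded.has_min (wellFounded_lt (α := Fin d))
      {i | μ'.parts i ≠ μ.parts i} hex
    exact ⟨i, hi, fun m hm => by_contra fun h => hmin m h hm⟩
  have hIio : ∑ m ∈ Finset.Iio i₀, μ'.parts m = ∑ m ∈ Finset.Iio i₀, μ.parts m :=
    Finset.sum_congr rfl fun m hm => hi₀min m (Finset.mem_Iio.1 hm)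
  have hi₀S := hle i₀
  have hi₀lt : μ'.parts i₀ < μ.parts i₀ := by
    rw [sum_Iic_eq, sum_Iic_eq] at hi₀S
    omega
  have hS₀ : ∑ m ∈ Finset.Iic i₀, μ'.parts m < ∑ m ∈ Finset.Iic i₀, μ.parts m := by
    rw [sum_Iic_eq, sum_Iic_eq]
    omega
  -- Here `j₀` is the first position after `i₀` where the partial sums agree again; between them
  -- there is slack at least one.
  obtain ⟨j₀, ⟨hij₀, hj₀⟩, hj₀min⟩ : ∃ j, (i₀ < j ∧
      ∑ m ∈ Finset.Iic j, μ'.parts m = ∑ m ∈ Finset.Iic j, μ.parts m) ∧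
      ∀ l, i₀ ≤ l → l < j → ∑ m ∈ Finset.Iic l, μ'.parts m < ∑ m ∈ Finset.Iic l, μ.parts m := by
    have hex : ∃ j, i₀ < j ∧
        ∑ m ∈ Finset.Iic j, μ'.parts m = ∑ m ∈ Finset.Iic j, μ.parts m := by
      have hd : d - 1 < d := by have := i₀.2; omega
      have hlast : Finset.Iic (⟨d - 1, hd⟩ : Fin d) = Finset.univ := by
        ext m
        simp only [Finset.mem_Iic, Fin.le_def, Finset.mem_univ, iff_true]
        omega
      refine ⟨⟨d - 1, hd⟩, lt_of_le_of_ne ?_ fun h => ?_, by rw [hlast]; exact hs⟩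
      · simp only [Fin.le_def]; omega
      · rw [h, hlast] at hS₀
        exact hS₀.ne hs
    obtain ⟨j, hj, hmin⟩ := WellFounded.has_min (wellFounded_lt (α := Fin d))
      {j | i₀ < j ∧ ∑ m ∈ Finset.Iic j, μ'.parts m = ∑ m ∈ Finset.Iic j, μ.parts m} hex
    refine ⟨j, hj, fun l hl hlj => ?_⟩
    rcases hl.eq_or_lt with rfl | hl
    · exact hS₀
    · exact lt_of_le_of_ne (hle l) fun h => hmin l ⟨hl, h⟩ hlj
  have hj₀gt : μ.parts j₀ < μ'.parts j₀ := by
    have h1 := sum_Iio_lt hij₀ hj₀min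
    rw [sum_Iic_eq, sum_Iic_eq] at hj₀
    omega
  -- Taking the last part equal to `μ'_(i₀)` and the first equal to `μ'_(j₀)` keeps the moved tuple
  -- sorted.
  obtain ⟨i, hi, himax⟩ := Finset.exists_max_image
    (Finset.univ.filter fun m => μ'.parts m = μ'.parts i₀) id ⟨i₀, by simp⟩
  obtain ⟨j, hj, hjmin⟩ := Finset.exists_min_image
    (Finset.univ.filter fun m => μ'.parts m = μ'.parts j₀) id ⟨j₀, by simp⟩
  simp only [Finset.mem_filter, Finset.mem_univ, true_and, id] at hi himax hj hjmin
  have hi₀i : i₀ ≤ i := himax i₀ rfl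
  have hjj₀ : j ≤ j₀ := hjmin j₀ rfl
  -- From `μ'_(i₀) < μ_(i₀) ≤ μ_(j₀) < μ'_(j₀)`.
  have hgap : μ'.parts i + 2 ≤ μ'.parts j := by
    have := μ.mono hij₀.le
    omega
  have hij : i < j := not_le.1 fun h => by have := μ'.mono h; omega
  have hupper : ∀ m, i < m → μ'.parts i + 1 ≤ μ'.parts m := fun m hm =>
    lt_of_le_of_ne (μ'.mono hm.le) fun h => absurd (himax m (h.symm.trans hi)) (not_le.2 hm)
  have hlower : ∀ m, m < j → μ'.parts m + 1 ≤ μ'.parts j := fun m hm =>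
    lt_of_le_of_ne (μ'.mono hm.le) fun h => absurd (hjmin m (h.trans hj)) (not_le.2 hm)
  let q : Fin d → ℕ := fun m =>
    if m = i then μ'.parts i + 1 else if m = j then μ'.parts j - 1 else μ'.parts m
  have hqi : q i = μ'.parts i + 1 := if_pos rfl
  have hqj : q j = μ'.parts j - 1 := by simp only [q, if_neg hij.ne', if_true]
  have hqrest : ∀ m, m ≠ i → m ≠ j → q m = μ'.parts m := fun m h1 h2 => by
    simp only [q, if_neg h1, if_neg h2]
  have hq1 : ∀ m, 1 ≤ q m := by
    intro m
    by_cases hmi : m = i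
    · rw [hmi, hqi]; omega
    by_cases hmj : m = j
    · rw [hmj, hqj]; omega
    rw [hqrest m hmi hmj]
    exact μ'.one_le m
  have hqmono : Monotone q := by
    intro m m' hmm'
    rcases hmm'.eq_or_lt with rfl | hlt
    · exact le_rfl
    have h0 := μ'.mono hmm'
    by_cases hmi : m = i
    · subst hmi
      have h1 := hupper m' hlt
      by_cases hmj' : m' = j
      · rw [hmj', hqi, hqj]; omega
      · rw [hqi, hqrest m' hlt.ne' hmj']; omega
    by_cases hmj : m = j
    · subst hmj
      rw [hqj, hqrest m' (hij.trans hlt).ne' hlt.ne']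
      omega
    rw [hqrest m hmi hmj]
    by_cases hmi' : m' = i
    · rw [hmi', hqi]; rw [hmi'] at h0; omega
    by_cases hmj' : m' = j
    · have h1 := hlower m (hmj' ▸ hlt)
      rw [hmj', hqj]; omega
    rw [hqrest m' hmi' hmj']
    exact h0
  refine ⟨⟨q, hq1, hqmono⟩, i, j, hij, hgap, hqi, hqj, hqrest, fun l => ?_⟩
  have h1 := sum_eq_of_move hqi (by rw [hqj]; omega) hqrest (Finset.Iic l)
  have h2 := hle l
  simp only [Finset.mem_Iic] at h1
  change ∑ m ∈ Finset.Iic l, q m ≤ _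
  by_cases hil : i ≤ l
  · by_cases hjl : j ≤ l
    · simp only [hil, hjl, if_true] at h1
      omega
    -- Only for `i ≤ l < j` does the partial sum grow, by one, and there the slack between `i₀` and
    -- `j₀` absorbs it.
    · have h3 := hj₀min l (hi₀i.trans hil) (lt_of_lt_of_le (not_le.1 hjl) hjj₀)
      simp only [hil, hjl, if_true, if_false] at h1
      omega
  · have hjl : ¬ j ≤ l := fun h => hil (hij.le.trans h)
    simp only [hil, hjl, if_false] at h1
    omega

end Dominance

/-! ### Chains of moves and the closure theorem -/

theorem stratum_subset_closure {k : Type*} [Field k] [Infinite k] {n d : ℕ}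
    {μ μ' : DPartPartition d} (hle : μ' ≤ μ) (hs : μ'.size = μ.size) :
    stratum k n d μ' ⊆ closure (stratum k n d μ) := by
  -- The sum of all partial sums strictly increases with each move and is bounded by `Φ μ`, so
  -- chains of moves terminate at `μ`.
  let Φ : DPartPartition d → ℕ := fun ν => ∑ l, ∑ m ∈ Finset.Iic l, ν.parts m
  induction h : Φ μ - Φ μ' using Nat.strong_induction_on generalizing μ' with
  | _ N ih =>
    by_cases hne : μ' = μ
    · rw [hne]; exact subset_closure
    obtain ⟨ν, i, j, hij, hgap, hi, hj, hrest, hν⟩ := exists_move hle hs hne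
    have hsum := sum_eq_of_move hi (by rw [hj]; omega) hrest
    have hsize : ν.size = μ'.size := by
      have := hsum Finset.univ
      simpa [DPartPartition.size] using this
    have h1 : Φ μ' < Φ ν := by
      refine Finset.sum_lt_sum (fun l _ => ?_) ⟨i, Finset.mem_univ i, ?_⟩
      · have := hsum (Finset.Iic l)
        simp only [Finset.mem_Iic] at this
        by_cases hjl : j ≤ l
        · simp only [hjl, hij.le.trans hjl, if_true] at this
          omega
        · simp only [hjl, if_false] at this
          omega
      · have := hsum (Finset.Iic i)
        simp only [Finset.mem_Iic, le_refl, not_le.2 hij, if_true, if_false] at this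
        omega
    have h2 : Φ ν ≤ Φ μ := Finset.sum_le_sum fun l _ => hν l
    refine (stratum_subset_closure_of_move hij.ne hgap hi hj hrest hsize).trans ?_
    exact closure_minimal (ih (Φ μ - Φ ν) (by omega) hν (hsize.trans hs) rfl) isClosed_closure

end RatCurve

theorem theorem3p6 {k : Type*} [Field k] [Infinite k] (n d : ℕ) (hd : 2 ≤ d) (hnd : d ≤ n)
    (μ : RatCurve.DPartPartition d) (hμ : μ.size = n) :
    closure (RatCurve.stratum k n d μ) =
      ⋃ μ' ∈ {μ' : RatCurve.DPartPartition d | μ'.size = n ∧ μ' ≤ μ},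
        RatCurve.stratum k n d μ' := by
  ext a
  simp only [Set.mem_iUnion, Set.mem_ofPred_eq, exists_prop]
  constructor
  · intro ha
    obtain ⟨μ', h⟩ := RatCurve.exists_hasMuType a
    exact ⟨μ', ⟨RatCurve.size_eq_of_mem_stratum h, RatCurve.le_of_mem_closure ha h⟩, h⟩
  · rintro ⟨μ', ⟨hs, hle⟩, h⟩
    exact RatCurve.stratum_subset_closure hle (hs.trans hμ.symm) h
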